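/- Let $\mathcal H$ be a separable complex Hilbert space with an orthogonal decomposition $\mathcal H=\mathcal H_+\oplus\mathcal H_-$ into infinite-dimensional closed subspaces, and let $P_+$ be the orthogonal projector onto $\mathcal H_+$. Write $L^2(E,F)$ for the space of Hilbert--Schmidt operators with the Hilbert--Schmidt norm, $U_+$ for the unitary group of $\mathcal H_+$ (a Banach Lie group, as a submanifold of the bounded operators on $\mathcal H_+$) and $\mathfrak u_+$ for the space of skew-adjoint bounded operators on $\mathcal H_+$. The restricted Grassmannian $\mathrm{Gr}_{\rm res}$ is the set of closed subspaces $W\subset\mathcal H$ for which the orthogonal projection $W\to\mathcal H_+$ is Fredholm and the orthogonal projection $W\to\mathcal H_-$ is Hilbert--Schmidt; $W$ is identified with its orthogonal projector $P_W$. Its manifold structure is given by the charts $$\phi_W(V)=P_{W^\perp}(P_W|_V)^{-1}\in L^2(W,W^\perp),\qquad W\in \mathrm{Gr}_{\rm res},$$ defined for those $V\in\mathrm{Gr}_{\rm res}$ for which $P_W|_V:V\to W$ is invertible. Let $$\mathfrak U_{\rm res}=\{u \text{ a partial isometry on }\mathcal H\;:\; u^*u,\,uu^*\in\mathrm{Gr}_{\rm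 res}\},$$ and let $U_{\rm res}$ be the Banach Lie group of unitary operators $g$ on $\mathcal H$ with $[g,P_+]\in L^2(\mathcal H)$, with the structure induced by the norm $\|X\|+\|[X,P_+]\|_2$. A local cross section $(\Omega_\beta,\sigma_\beta)$ based at $W_\beta\in \mathrm{Gr}_{\rm res}$ consists of an open set $\Omega_\beta\ni W_\beta$ contained in the domain of $\phi_{W_\beta}$ and of a smooth map $\sigma_\beta:\Omega_\beta\to U_{\rm res}$ with $\sigma_\beta(W)\mathcal H_+=W$ for all $W\in\Omega_\beta$. Then there is a local cross section based at every point of $\mathrm{Gr}_{\rm res}$, and there is a smooth chart $\psi:V\to\mathfrak u_+$ of $U_+$ around every point of $U_+$. Moreover, let $(\Omega_\beta,\sigma_\beta)_\beta$ be any family of local cross sections covering $\mathrm{Gr}_{\rm res}$, let $(V_\alpha,\psi_\alpha:V_\alpha\to\mathfrak u_+)_\alpha$ be any family of smooth charts covering $U_+$, and consider on $\mathfrak U_{\rm res}$ the charts $$\Phi_{\alpha\beta\gamma}(u)=\big(\phi_{W_\gamma}(uu^*),\ \phi_{W_\beta}(u^*u),\ \psi_\alpha(\sigma_\gamma(uu^*)^{-1}u\,\sigma_\beta(u^*u)|_{\mathcal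 H_+})\big)\in L^2(W_\gamma,W_\gamma^\perp)\times L^2(W_\beta,W_\beta^\perp)\times\mathfrak u_+ ,$$ $$\Omega_{\alpha\beta\gamma}=\{u\in\mathfrak U_{\rm res}: u^*u\in\Omega_\beta,\ uu^*\in\Omega_\gamma,\ \sigma_\gamma(uu^*)^{-1}u\,\sigma_\beta(u^*u)|_{\mathcal H_+}\in V_\alpha\}.$$ Then the following holds. (1) With the atlases $(\phi_W)$ and $(\Phi_{\alpha\beta\gamma})$, the maps $s(u)=u^*u$, $t(u)=uu^*$, $m(u_1,u_2)=u_1u_2$ (for $s(u_1)=t(u_2)$), $\epsilon(p)=p$ and $\iota(u)=u^*$ make $\mathfrak U_{\rm res}\rightrightarrows\mathrm{Gr}_{\rm res}$ a Banach Lie groupoid: both are Hausdorff smooth real Banach manifolds; $s$ and $t$ are surjective submersions (smooth, with surjective tangent maps whose kernels split); $m$ is smooth on the set of composable pairs and associative, in the sense that $(gh)k$ is defined if and only if $g(hk)$ is, and then they are equal; $\epsilon$ is a topological embedding with $g\,\epsilon(s(g))=g=\epsilon(t(g))\,g$; and $\iota$ is a diffeomorphism with $g\,\iota(g)=\epsilon(t(g))$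 and $\iota(g)\,g=\epsilon(s(g))$. (2) The image of $\Phi_{\alpha\beta\gamma}$ is $\phi_{W_\gamma}(\Omega_\gamma)\times\phi_{W_\beta}(\Omega_\beta)\times\psi_\alpha(V_\alpha)$, and in the charts $\Phi_{\alpha\beta\gamma}$, $\phi_{W_\gamma}$, $\phi_{W_\beta}$ the target and the source are the projections $(A,B,X)\mapsto A$ and $(A,B,X)\mapsto B$. (3) If $\Phi_{\alpha\beta\gamma}(u)=(A,B,X)$ and $\psi_\alpha^{-1}(X)^*\in V_{\alpha'}$, then $u^*\in\Omega_{\alpha'\gamma\beta}$ and $\Phi_{\alpha'\gamma\beta}(u^*)=(B,A,\psi_{\alpha'}(\psi_\alpha^{-1}(X)^*))$. (4) If $\Phi_{\alpha\beta\gamma}(u)=(A,B,X)$, $\Phi_{\alpha'\beta'\beta}(v)=(B,C,X')$ and $\psi_\alpha^{-1}(X)\psi_{\alpha'}^{-1}(X')\in V_{\alpha''}$, then $s(u)=t(v)$, $uv\in\Omega_{\alpha''\beta'\gamma}$ and $\Phi_{\alpha''\beta'\gamma}(uv)=(A,C,\psi_{\alpha''}(\psi_\alpha^{-1}(X)\psi_{\alpha'}^{-1}(X')))$.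 -/

import Mathlib

open scoped ContDiff InnerProductSpace ENNReal Topology

universe u

namespace RestrictedGroupoid

noncomputable section

/-! ### Hilbert–Schmidt operators -/

section HilbertSchmidt

variable {E F : Type u} [NormedAddCommGroup E] [InnerProductSpace ℂ E]
  [NormedAddCommGroup F] [InnerProductSpace ℂ F]

/-- The Hilbert–Schmidt norm `‖T‖₂`, with value `∞` if `T` is not Hilbert–Schmidt: the supremum of
`(∑ ‖T eᵢ‖²)^(1/2)` over all finite orthonormal families. It equals `(∑ ‖T bᵢ‖²)^(1/2)` for every
orthonormal basis `b`, see `hsENorm_eq_tsum`. -/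
def hsENorm (T : E →L[ℂ] F) : ℝ≥0∞ :=
  ⨆ (n : ℕ) (e : Fin n → E) (_ : Orthonormal ℂ e), (∑ i, ‖T (e i)‖ₑ ^ (2 : ℝ)) ^ (1 / (2 : ℝ))

/-- `T` is a Hilbert–Schmidt operator. -/
def IsHilbertSchmidt (T : E →L[ℂ] F) : Prop := hsENorm T ≠ ⊤

theorem le_hsENorm (T : E →L[ℂ] F) {n : ℕ} {e : Fin n → E} (he : Orthonormal ℂ e) :
    (∑ i, ‖T (e i)‖ₑ ^ (2 : ℝ)) ^ (1 / (2 : ℝ)) ≤ hsENorm T :=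
  le_iSup_of_le n (le_iSup_of_le e (le_iSup_of_le he le_rfl))

theorem hsENorm_le {T : E →L[ℂ] F} {C : ℝ≥0∞}
    (h : ∀ (n : ℕ) (e : Fin n → E), Orthonormal ℂ e →
      (∑ i, ‖T (e i)‖ₑ ^ (2 : ℝ)) ^ (1 / (2 : ℝ)) ≤ C) : hsENorm T ≤ C :=
  iSup_le fun n => iSup_le fun e => iSup_le fun he => h n e he

theorem hsENorm_zero : hsENorm (0 : E →L[ℂ] F) = 0 :=
  le_antisymm (hsENorm_le fun n e _ => by simp) bot_le

theorem hsENorm_add_le (S T : E →L[ℂ] F) : hsENorm (S + T) ≤ hsENorm S + hsENorm T := by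
  refine hsENorm_le fun n e he => ?_
  calc (∑ i, ‖(S + T) (e i)‖ₑ ^ (2 : ℝ)) ^ (1 / (2 : ℝ))
      ≤ (∑ i, (‖S (e i)‖ₑ + ‖T (e i)‖ₑ) ^ (2 : ℝ)) ^ (1 / (2 : ℝ)) := by
        gcongr with i
        exact enorm_add_le _ _
    _ ≤ (∑ i, ‖S (e i)‖ₑ ^ (2 : ℝ)) ^ (1 / (2 : ℝ)) + (∑ i, ‖T (e i)‖ₑ ^ (2 : ℝ)) ^ (1 / (2 : ℝ)) :=
        ENNReal.Lp_add_le _ _ _ (by norm_num)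
    _ ≤ hsENorm S + hsENorm T := add_le_add (le_hsENorm S he) (le_hsENorm T he)

theorem hsENorm_smul_le (c : ℂ) (T : E →L[ℂ] F) : hsENorm (c • T) ≤ ‖c‖ₑ * hsENorm T := by
  refine hsENorm_le fun n e he => ?_
  have h : (∑ i, ‖(c • T) (e i)‖ₑ ^ (2 : ℝ)) ^ (1 / (2 : ℝ))
      = ‖c‖ₑ * (∑ i, ‖T (e i)‖ₑ ^ (2 : ℝ)) ^ (1 / (2 : ℝ)) := by
    simp only [smul_apply, enorm_smul]
    simp_rw [ENNReal.mul_rpow_of_nonneg _ _ (by norm_num : (0 : ℝ) ≤ 2)]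
    rw [← Finset.mul_sum, ENNReal.mul_rpow_of_nonneg _ _ (by norm_num : (0 : ℝ) ≤ 1 / 2),
      ← ENNReal.rpow_mul]
    norm_num
  rw [h]
  gcongr
  exact le_hsENorm T he

theorem hsENorm_neg_le (T : E →L[ℂ] F) : hsENorm (-T) ≤ hsENorm T := by
  simpa using hsENorm_smul_le (-1) T

theorem enorm_apply_le (T : E →L[ℂ] F) {x : E} (hx : ‖x‖ = 1) : ‖T x‖ₑ ≤ hsENorm T := by
  have he : Orthonormal ℂ (fun _ : Fin 1 => x) :=
    ⟨fun _ => hx, fun i j hij => absurd (Subsingleton.elim i j) hij⟩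
  have h := le_hsENorm T he
  simp only [Finset.univ_unique, Finset.sum_singleton] at h
  rwa [← ENNReal.rpow_mul, mul_one_div_cancel two_ne_zero, ENNReal.rpow_one] at h

theorem norm_apply_le {T : E →L[ℂ] F} (hT : IsHilbertSchmidt T) (x : E) :
    ‖T x‖ ≤ (hsENorm T).toReal * ‖x‖ := by
  by_cases hx : x = 0
  · simp [hx]
  have hx' : ‖x‖ ≠ 0 := norm_ne_zero_iff.2 hx
  have h1 : ‖((‖x‖⁻¹ : ℝ) : ℂ) • x‖ = 1 := by simp [norm_smul, hx']
  have h2 := ENNReal.toReal_mono hT (enorm_apply_le T h1)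
  rw [toReal_enorm, map_smul, norm_smul] at h2
  simp only [Complex.norm_real, norm_inv, norm_norm] at h2
  rwa [inv_mul_le_iff₀ (by positivity), mul_comm] at h2

/-- The usual description of the Hilbert–Schmidt norm through an orthonormal basis. -/
theorem hsENorm_eq_tsum [CompleteSpace E] [CompleteSpace F] {ι : Type*} (b : HilbertBasis ι ℂ E)
    (T : E →L[ℂ] F) : hsENorm T = (∑' i, ‖T (b i)‖ₑ ^ (2 : ℝ)) ^ (1 / (2 : ℝ)) := by
  have hsq : ∀ {G : Type u} [NormedAddCommGroup G] (x : G),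
      ‖x‖ₑ ^ (2 : ℝ) = ENNReal.ofReal (‖x‖ ^ 2) := fun x => by
    rw [← ofReal_norm, ENNReal.rpow_ofNat, ENNReal.ofReal_pow (norm_nonneg x)]
  have hsqC : ∀ x : ℂ, ‖x‖ₑ ^ (2 : ℝ) = ENNReal.ofReal (‖x‖ ^ 2) := fun x => by
    rw [← ofReal_norm, ENNReal.rpow_ofNat, ENNReal.ofReal_pow (norm_nonneg x)]
  apply le_antisymm
  · refine hsENorm_le fun n e he => ?_
    gcongr
    let K : Submodule ℂ F := Submodule.span ℂ (Set.range fun k => T (e k))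
    have : FiniteDimensional ℂ K := FiniteDimensional.span_of_finite ℂ (Set.finite_range _)
    let f := stdOrthonormalBasis ℂ K
    let g : Fin (Module.finrank ℂ K) → E := fun j => T.adjoint (f j : F)
    have hf : Orthonormal ℂ fun j => (f j : F) :=
      f.orthonormal.comp_linearIsometry K.subtypeₗᵢ
    have h1 : ∀ k, ‖T (e k)‖ₑ ^ (2 : ℝ) = ∑ j, ‖⟪e k, g j⟫_ℂ‖ₑ ^ (2 : ℝ) := fun k => by
      have hk : T (e k) ∈ K := Submodule.subset_span ⟨k, rfl⟩
      have := f.sum_sq_norm_inner_left ⟨T (e k), hk⟩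
      simp_rw [hsqC, hsq]
      rw [← ENNReal.ofReal_sum_of_nonneg fun _ _ => by positivity]
      congr 1
      refine this.symm.trans ?_
      refine Finset.sum_congr rfl fun j _ => ?_
      rw [ContinuousLinearMap.adjoint_inner_right]
      rfl
    have h2 : ∀ j, ∑ k, ‖⟪e k, g j⟫_ℂ‖ₑ ^ (2 : ℝ) ≤ ‖g j‖ₑ ^ (2 : ℝ) := fun j => by
      simp_rw [hsqC, hsq]
      rw [← ENNReal.ofReal_sum_of_nonneg fun _ _ => by positivity]
      exact ENNReal.ofReal_le_ofReal (he.sum_inner_products_le (g j))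
    have h3 : ∀ j, ‖g j‖ₑ ^ (2 : ℝ) = ∑' i, ‖⟪b i, g j⟫_ℂ‖ₑ ^ (2 : ℝ) := fun j => by
      have hs := b.hasSum_inner_mul_inner (g j) (g j)
      have hs' : HasSum (fun i => ‖⟪b i, g j⟫_ℂ‖ ^ 2) (‖g j‖ ^ 2) := by
        have := Complex.hasSum_re hs
        convert! this using 1
        · ext i
          have h := inner_mul_symm_re_eq_norm (𝕜 := ℂ) (g j) (b i)
          rw [norm_mul, norm_inner_symm, ← sq] at h
          exact h.symm
        · exact (inner_self_eq_norm_sq (𝕜 := ℂ) (g j)).symm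
      simp_rw [hsqC, hsq]
      rw [← ENNReal.ofReal_tsum_of_nonneg (fun _ => by positivity) hs'.summable, hs'.tsum_eq]
    have h4 : ∀ i, ∑ j, ‖⟪b i, g j⟫_ℂ‖ₑ ^ (2 : ℝ) ≤ ‖T (b i)‖ₑ ^ (2 : ℝ) := fun i => by
      simp_rw [hsqC, hsq]
      rw [← ENNReal.ofReal_sum_of_nonneg fun _ _ => by positivity]
      refine ENNReal.ofReal_le_ofReal ?_
      have := hf.sum_inner_products_le (s := Finset.univ) (T (b i))
      refine le_trans (le_of_eq (Finset.sum_congr rfl fun j _ => ?_)) this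
      rw [ContinuousLinearMap.adjoint_inner_right, norm_inner_symm]
    calc ∑ k, ‖T (e k)‖ₑ ^ (2 : ℝ) = ∑ j, ∑ k, ‖⟪e k, g j⟫_ℂ‖ₑ ^ (2 : ℝ) := by
          rw [Finset.sum_comm]
          exact Finset.sum_congr rfl fun k _ => h1 k
      _ ≤ ∑ j, ∑' i, ‖⟪b i, g j⟫_ℂ‖ₑ ^ (2 : ℝ) :=
          Finset.sum_le_sum fun j _ => (h2 j).trans (h3 j).le
      _ = ∑' i, ∑ j, ‖⟪b i, g j⟫_ℂ‖ₑ ^ (2 : ℝ) :=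
          (Summable.tsum_finsetSum fun _ _ => ENNReal.summable).symm
      _ ≤ ∑' i, ‖T (b i)‖ₑ ^ (2 : ℝ) := ENNReal.tsum_le_tsum h4
  · rw [one_div, ENNReal.rpow_inv_le_iff (by norm_num)]
    refine ENNReal.summable.tsum_le_of_sum_le fun s => ?_
    have he : Orthonormal ℂ fun k : Fin s.card => b (s.equivFin.symm k) :=
      b.orthonormal.comp _ (Subtype.val_injective.comp s.equivFin.symm.injective)
    have h := le_hsENorm T he
    rw [one_div, ENNReal.rpow_inv_le_iff (by norm_num)] at h
    refine le_trans (le_of_eq ?_) h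
    rw [← Finset.sum_coe_sort s]
    exact (s.equivFin.symm.sum_comp fun i : s => ‖T (b i)‖ₑ ^ (2 : ℝ)).symm

variable (E F) in
/-- The Hilbert–Schmidt operators as a subspace of the bounded operators. -/
def hilbertSchmidt : Submodule ℂ (E →L[ℂ] F) where
  carrier := {T | IsHilbertSchmidt T}
  zero_mem' := by simp [IsHilbertSchmidt, hsENorm_zero]
  add_mem' {S T} hS hT :=
    ne_top_of_le_ne_top (ENNReal.add_ne_top.2 ⟨hS, hT⟩) (hsENorm_add_le S T)
  smul_mem' c T hT :=
    ne_top_of_le_ne_top (ENNReal.mul_ne_top enorm_ne_top hT) (hsENorm_smul_le c T)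

variable (E F) in
/-- The space `L²(E, F)` of Hilbert–Schmidt operators; a separate type, since it carries the
Hilbert–Schmidt norm and not the operator norm. -/
def HS : Type u := ↥(hilbertSchmidt E F)

namespace HS

instance : AddCommGroup (HS E F) := inferInstanceAs (AddCommGroup ↥(hilbertSchmidt E F))

instance : Module ℂ (HS E F) := inferInstanceAs (Module ℂ ↥(hilbertSchmidt E F))

/-- The bounded operator underlying a Hilbert–Schmidt operator. -/
def toCLM : HS E F →ₗ[ℂ] (E →L[ℂ] F) := (hilbertSchmidt E F).subtype

theorem isHilbertSchmidt (T : HS E F) : IsHilbertSchmidt (toCLM T) := T.2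

theorem toCLM_injective : Function.Injective (toCLM (E := E) (F := F)) := Subtype.val_injective

theorem exists_toCLM_eq {T : E →L[ℂ] F} (hT : IsHilbertSchmidt T) : ∃ S : HS E F, toCLM S = T :=
  ⟨(⟨T, hT⟩ : ↥(hilbertSchmidt E F)), rfl⟩

open Classical in
/-- A bounded operator as an element of `L²(E, F)`; it is only used for Hilbert–Schmidt
operators (junk value `0` otherwise). -/
def ofCLM (T : E →L[ℂ] F) : HS E F := 
  if h : T ∈ hilbertSchmidt E F then (⟨T, h⟩ : ↥(hilbertSchmidt E F)) else (0 : HS E F)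

instance : Norm (HS E F) := ⟨fun T => (hsENorm (toCLM T)).toReal⟩

theorem norm_def (T : HS E F) : ‖T‖ = (hsENorm (toCLM T)).toReal := rfl

theorem norm_apply_le (T : HS E F) (x : E) : ‖toCLM T x‖ ≤ ‖T‖ * ‖x‖ :=
  RestrictedGroupoid.norm_apply_le T.isHilbertSchmidt x

instance : NormedAddCommGroup (HS E F) :=
  AddGroupNorm.toNormedAddCommGroup
    { toFun := fun T => ‖T‖
      map_zero' := by simp [norm_def, hsENorm_zero]
      add_le' := fun S T => by
        rw [norm_def, norm_def, norm_def, map_add,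
          ← ENNReal.toReal_add S.isHilbertSchmidt T.isHilbertSchmidt]
        exact ENNReal.toReal_mono
          (ENNReal.add_ne_top.2 ⟨S.isHilbertSchmidt, T.isHilbertSchmidt⟩) (hsENorm_add_le _ _)
      neg' := fun T => by
        have h : hsENorm (-toCLM T) = hsENorm (toCLM T) :=
          le_antisymm (hsENorm_neg_le _) (by simpa using hsENorm_neg_le (-toCLM T))
        rw [norm_def, norm_def, map_neg, h]
      eq_zero_of_map_eq_zero' := fun T hT => by
        apply toCLM_injective
        ext x
        have h := norm_apply_le T x
        rw [show ‖T‖ = 0 from hT, zero_mul] at h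
        simpa using h }

instance : NormedSpace ℂ (HS E F) where
  norm_smul_le c T := by
    change (hsENorm (toCLM (c • T))).toReal ≤ ‖c‖ * (hsENorm (toCLM T)).toReal
    rw [map_smul, ← toReal_enorm c, ← ENNReal.toReal_mul]
    exact ENNReal.toReal_mono (ENNReal.mul_ne_top enorm_ne_top T.isHilbertSchmidt)
      (hsENorm_smul_le _ _)

instance [CompleteSpace F] : CompleteSpace (HS E F) := by
  refine Metric.complete_of_cauchySeq_tendsto fun S hS => ?_
  have hop : ∀ A B : HS E F, dist (toCLM A) (toCLM B) ≤ dist A B := fun A B => by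
    rw [dist_eq_norm, dist_eq_norm, ← map_sub]
    exact ContinuousLinearMap.opNorm_le_bound _ (norm_nonneg _) (norm_apply_le _)
  have hS' : CauchySeq fun k => toCLM (S k) := by
    rw [Metric.cauchySeq_iff'] at hS ⊢
    intro ε hε
    obtain ⟨N, hN⟩ := hS ε hε
    exact ⟨N, fun n hn => (hop _ _).trans_lt (hN n hn)⟩
  obtain ⟨T, hT⟩ := cauchySeq_tendsto_of_complete hS'
  have key : ∀ ε : ℝ, 0 < ε → ∃ N, ∀ k ≥ N,
      hsENorm (toCLM (S k) - T) ≤ ENNReal.ofReal ε := by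
    intro ε hε
    obtain ⟨N, hN⟩ := Metric.cauchySeq_iff.1 hS ε hε
    refine ⟨N, fun k hk => hsENorm_le fun n e he => ?_⟩
    have hlim : Filter.Tendsto
        (fun l => (∑ i, ‖(toCLM (S k) - toCLM (S l)) (e i)‖ₑ ^ (2 : ℝ)) ^ (1 / (2 : ℝ)))
        Filter.atTop (𝓝 ((∑ i, ‖(toCLM (S k) - T) (e i)‖ₑ ^ (2 : ℝ)) ^ (1 / (2 : ℝ)))) := by
      have hc : Continuous fun A : E →L[ℂ] F =>
          (∑ i, ‖(toCLM (S k) - A) (e i)‖ₑ ^ (2 : ℝ)) ^ (1 / (2 : ℝ)) := by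
        refine ENNReal.continuous_rpow_const.comp (continuous_finsetSum _ fun i _ => ?_)
        refine ENNReal.continuous_rpow_const.comp (continuous_enorm.comp ?_)
        fun_prop
      exact (hc.tendsto T).comp hT
    refine le_of_tendsto hlim (Filter.eventually_atTop.2 ⟨N, fun l hl => ?_⟩)
    refine (le_hsENorm _ he).trans ?_
    rw [← map_sub, ← ENNReal.ofReal_toReal (S k - S l).isHilbertSchmidt]
    refine ENNReal.ofReal_le_ofReal ?_
    rw [← norm_def, ← dist_eq_norm]
    exact (hN k hk l hl).le
  have hTHS : IsHilbertSchmidt T := by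
    obtain ⟨N, hN⟩ := key 1 one_pos
    have h1 : toCLM (S N) - T ∈ hilbertSchmidt E F :=
      ne_top_of_le_ne_top ENNReal.ofReal_ne_top (hN N le_rfl)
    have h2 := (hilbertSchmidt E F).sub_mem (S N).isHilbertSchmidt h1
    rwa [sub_sub_cancel] at h2
  obtain ⟨T', rfl⟩ := exists_toCLM_eq hTHS
  refine ⟨T', Metric.tendsto_atTop.2 fun ε hε => ?_⟩
  obtain ⟨N, hN⟩ := key (ε / 2) (half_pos hε)
  refine ⟨N, fun k hk => ?_⟩
  rw [dist_eq_norm, norm_def, map_sub]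
  refine lt_of_le_of_lt (ENNReal.toReal_mono ENNReal.ofReal_ne_top (hN k hk)) ?_
  rw [ENNReal.toReal_ofReal (half_pos hε).le]
  exact half_lt_self hε

end HS

end HilbertSchmidt

/-! ### Banach manifolds

The charts below take values in Banach spaces that vary with the chart, so a Banach manifold is
given by a set together with a smooth atlas whose charts each have their own model space. -/

/-- A chart of a set `M`, defined on `source`, with values in a real Banach space `E`. The values of
`toFun` outside `source` are irrelevant. -/
structure BanachChart (M : Type u) where
  E : Type u
  [normedAddCommGroup : NormedAddCommGroup E]
  [normedSpace : NormedSpace ℝ E]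
  [completeSpace : CompleteSpace E]
  source : Set M
  toFun : M → E

attribute [instance] BanachChart.normedAddCommGroup BanachChart.normedSpace
  BanachChart.completeSpace

section Manifold

variable {M N P : Type u}

open Classical in
/-- `f ∘ c⁻¹`, for a function `f` on `M` and a chart `c` (value `0` outside the image of `c`). -/
def BanachChart.pull (c : BanachChart M) {F : Type*} [Zero F] (f : M → F) : c.E → F := fun y =>
  if h : ∃ x ∈ c.source, c.toFun x = y then f h.choose else 0

/-- The topology defined by a set of charts, generated by the preimages of open sets. -/
@[reducible]
def atlasTopology (𝒜 : Set (BanachChart M)) : TopologicalSpace M :=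
  TopologicalSpace.generateFrom
    {U | ∃ c ∈ 𝒜, ∃ O : Set c.E, IsOpen O ∧ U = c.source ∩ c.toFun ⁻¹' O}

/-- `𝒜` is a smooth atlas which makes `M` into a (Hausdorff) Banach manifold. -/
structure IsBanachManifold (𝒜 : Set (BanachChart M)) : Prop where
  injOn : ∀ c ∈ 𝒜, Set.InjOn c.toFun c.source
  cover : ∀ x : M, ∃ c ∈ 𝒜, x ∈ c.source
  isOpen_image : ∀ c ∈ 𝒜, ∀ d ∈ 𝒜, IsOpen (c.toFun '' (c.source ∩ d.source))
  contDiffOn : ∀ c ∈ 𝒜, ∀ d ∈ 𝒜,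
    ContDiffOn ℝ ∞ (c.pull d.toFun) (c.toFun '' (c.source ∩ d.source))
  t2 : @T2Space M (atlasTopology 𝒜)

/-- The map `f` between Banach manifolds is smooth: all local representatives `d ∘ f ∘ c⁻¹` have
open domain (that is, `f` is continuous) and are smooth. -/
def IsSmoothMap (𝒜 : Set (BanachChart M)) (ℬ : Set (BanachChart N)) (f : M → N) : Prop :=
  ∀ c ∈ 𝒜, ∀ d ∈ ℬ,
    IsOpen (c.toFun '' (c.source ∩ f ⁻¹' d.source)) ∧
    ContDiffOn ℝ ∞ (c.pull fun x => d.toFun (f x)) (c.toFun '' (c.source ∩ f ⁻¹' d.source))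

/-- The map `f` between Banach manifolds is a submersion: it is smooth and each tangent map is
surjective with split kernel. -/
def IsSubmersionMap (𝒜 : Set (BanachChart M)) (ℬ : Set (BanachChart N)) (f : M → N) : Prop :=
  IsSmoothMap 𝒜 ℬ f ∧
  ∀ c ∈ 𝒜, ∀ d ∈ ℬ, ∀ x ∈ c.source, f x ∈ d.source →
    Function.Surjective (fderiv ℝ (c.pull fun x => d.toFun (f x)) (c.toFun x)) ∧
    (fderiv ℝ (c.pull fun x => d.toFun (f x)) (c.toFun x)).ker.ClosedComplemented

/-- The map `f` between Banach manifolds is a diffeomorphism. -/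
def IsDiffeo (𝒜 : Set (BanachChart M)) (ℬ : Set (BanachChart N)) (f : M → N) : Prop :=
  IsSmoothMap 𝒜 ℬ f ∧
  ∃ g : N → M, IsSmoothMap ℬ 𝒜 g ∧ Function.LeftInverse g f ∧ Function.RightInverse g f

/-- Smoothness of a map `f` defined on a subset `S` of a product of two Banach manifolds: near each
point of `S`, in charts, `f` is the restriction to `S` of a smooth map defined on an open set of the
product. If `S` is a (split) submanifold, this is smoothness for the submanifold structure. -/
def IsSmoothOnSubset (𝒜 : Set (BanachChart M)) (ℬ : Set (BanachChart N)) (𝒞 : Set (BanachChart P))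
    {S : M × N → Prop} (f : {z : M × N // S z} → P) : Prop :=
  ∀ c ∈ 𝒜, ∀ d ∈ ℬ, ∀ e ∈ 𝒞, ∀ z : {z : M × N // S z},
    z.1.1 ∈ c.source → z.1.2 ∈ d.source → f z ∈ e.source →
    ∃ (O : Set (c.E × d.E)) (F : c.E × d.E → e.E),
      IsOpen O ∧ (c.toFun z.1.1, d.toFun z.1.2) ∈ O ∧ ContDiffOn ℝ ∞ F O ∧
      ∀ w : {z : M × N // S z}, w.1.1 ∈ c.source → w.1.2 ∈ d.source →
        (c.toFun w.1.1, d.toFun w.1.2) ∈ O →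
        f w ∈ e.source ∧ e.toFun (f w) = F (c.toFun w.1.1, d.toFun w.1.2)

end Manifold

/-! ### Banach Lie groupoids -/

/-- `G ⇉ M`, with source `s`, target `t`, multiplication `m` of the composable pairs `(g, h)`,
`s g = t h`, identity section `ε` and inversion `i`, is a Banach Lie groupoid for the manifold
structures given by the atlases `𝒢` and `ℳ`. -/
structure IsBanachLieGroupoid {G M : Type u} (𝒢 : Set (BanachChart G)) (ℳ : Set (BanachChart M))
    (s t : G → M) (m : {z : G × G // s z.1 = t z.2} → G) (ε : M → G) (i : G → G) : Prop where
  manifold_total : IsBanachManifold 𝒢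
  manifold_base : IsBanachManifold ℳ
  source_surjective : Function.Surjective s
  source_submersion : IsSubmersionMap 𝒢 ℳ s
  target_surjective : Function.Surjective t
  target_submersion : IsSubmersionMap 𝒢 ℳ t
  mul_smooth : IsSmoothOnSubset 𝒢 𝒢 𝒢 m
  mul_defined_iff : ∀ g h k : G,
    (∃ gh : s g = t h, s (m ⟨(g, h), gh⟩) = t k) ↔ (∃ hk : s h = t k, s g = t (m ⟨(h, k), hk⟩))
  mul_assoc : ∀ (g h k : G) (gh : s g = t h) (ghk : s (m ⟨(g, h), gh⟩) = t k)
    (hk : s h = t k) (ghk' : s g = t (m ⟨(h, k), hk⟩)),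
    m ⟨(m ⟨(g, h), gh⟩, k), ghk⟩ = m ⟨(g, m ⟨(h, k), hk⟩), ghk'⟩
  unit_embedding : @Topology.IsEmbedding M G (atlasTopology ℳ) (atlasTopology 𝒢) ε
  mul_unit : ∀ (g : G) (x : M), s g = x → ∃ hgx : s g = t (ε x), m ⟨(g, ε x), hgx⟩ = g
  unit_mul : ∀ (g : G) (x : M), t g = x → ∃ hxg : s (ε x) = t g, m ⟨(ε x, g), hxg⟩ = g
  inv_diffeo : IsDiffeo 𝒢 𝒢 i
  mul_inv : ∀ g : G, ∃ h : s g = t (i g), m ⟨(g, i g), h⟩ = ε (t g)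
  inv_mul : ∀ g : G, ∃ h : s (i g) = t g, m ⟨(i g, g), h⟩ = ε (s g)

/-! ### The unitary group of a Hilbert space -/

section Unitary

variable (K : Type u) [NormedAddCommGroup K] [InnerProductSpace ℂ K] [CompleteSpace K]

/-- The Banach Lie algebra of skew-adjoint bounded operators on `K`, with the operator norm. -/
def SkewOp : Type u := ↥(skewAdjoint.submodule ℝ (K →L[ℂ] K))

instance : NormedAddCommGroup (SkewOp K) :=
  inferInstanceAs (NormedAddCommGroup ↥(skewAdjoint.submodule ℝ (K →L[ℂ] K)))

instance : NormedSpace ℝ (SkewOp K) :=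
  inferInstanceAs (NormedSpace ℝ ↥(skewAdjoint.submodule ℝ (K →L[ℂ] K)))

instance : CompleteSpace (SkewOp K) := by
  refine completeSpace_coe_iff_isComplete.2 (IsClosed.isComplete ?_)
  exact isClosed_eq continuous_star continuous_neg

/-- A smooth chart of the unitary group of `K`, with values in the space of skew-adjoint operators.
The unitary group has its usual structure of Banach Lie group, that is, it is a submanifold of the
space of bounded operators: a chart is a bijection from a (relatively) open set of unitary operators
onto an open set of skew-adjoint operators which is smooth (locally the restriction of a smooth map
on an open set of bounded operators) with smooth inverse. -/
structure UnitaryChart where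
  source : Set (K →L[ℂ] K)
  toFun : (K →L[ℂ] K) → SkewOp K
  isOpen_source : ∃ O : Set (K →L[ℂ] K), IsOpen O ∧ source = O ∩ unitary (K →L[ℂ] K)
  injOn : Set.InjOn toFun source
  isOpen_image : IsOpen (toFun '' source)
  smooth : ∀ k ∈ source, ∃ F : (K →L[ℂ] K) → SkewOp K,
    ContDiffAt ℝ ∞ F k ∧ ∀ᶠ l in 𝓝[source] k, F l = toFun l
  smooth_symm : ContDiffOn ℝ ∞ (Function.invFunOn toFun source) (toFun '' source)

variable {K} in
/-- The inverse of a chart of the unitary group. -/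
def UnitaryChart.symm (a : UnitaryChart K) : SkewOp K → (K →L[ℂ] K) :=
  Function.invFunOn a.toFun a.source

end Unitary

/-! ### The restricted Grassmannian

`H` is a Hilbert space and `Hp` (for `H₊`) is a closed (that is, complete) subspace; `H₋` is the
orthogonal complement `Hpᗮ`. -/

section Restricted

variable {H : Type u} [NormedAddCommGroup H] [InnerProductSpace ℂ H] [CompleteSpace H]

/-- The closed subspaces `W` of `H` such that the orthogonal projection `W → H₊` is Fredholm and the
orthogonal projection `W → H₋` is Hilbert–Schmidt. -/
def restrictedSubspaces (Hp : Submodule ℂ H) [CompleteSpace Hp] : Set (Submodule ℂ H) :=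
  {W | IsClosed (W : Set H) ∧
    ContinuousLinearMap.IsFredholm (Hp.orthogonalProjectionOnto ∘L W.subtypeL) ∧
    IsHilbertSchmidt (Hpᗮ.orthogonalProjectionOnto ∘L W.subtypeL)}

/-- The restricted Grassmannian; a subspace `W` is identified with its orthogonal projector. -/
@[ext]
structure GrRes (Hp : Submodule ℂ H) [CompleteSpace Hp] where
  proj : H →L[ℂ] H
  isStarProjection : IsStarProjection proj
  range_mem : proj.range ∈ restrictedSubspaces Hp

variable {Hp : Submodule ℂ H} [CompleteSpace Hp]

/-- The subspace `W` onto which the projector projects. -/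
def GrRes.space (W : GrRes Hp) : Submodule ℂ H := W.proj.range

instance (W : GrRes Hp) : CompleteSpace W.space :=
  completeSpace_coe_iff_isComplete.2 (IsClosed.isComplete W.range_mem.1)

/-- The restriction `P_W|_V : V → W` of the orthogonal projection onto `W`. -/
def GrRes.projRestrict (W V : GrRes Hp) : V.space →L[ℂ] W.space :=
  W.space.orthogonalProjectionOnto ∘L V.space.subtypeL

/-- `φ_W(V) = P_{W^⊥} (P_W|_V)⁻¹`, the operator `W → W^⊥` with graph `V`. -/
def GrRes.coord (W V : GrRes Hp) : HS W.space W.spaceᗮ :=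
  HS.ofCLM (W.spaceᗮ.orthogonalProjectionOnto ∘L V.space.subtypeL ∘L (W.projRestrict V).inverse)

/-- The chart `φ_W` of the restricted Grassmannian, with values in `L²(W, W^⊥)`. -/
def GrRes.chart (W : GrRes Hp) : BanachChart (GrRes Hp) where
  E := HS W.space W.spaceᗮ
  source := {V | (W.projRestrict V).IsInvertible}
  toFun := W.coord

variable (Hp) in
/-- The atlas of the restricted Grassmannian. -/
def grAtlas : Set (BanachChart (GrRes Hp)) := Set.range GrRes.chart

/-! ### Partial isometries over the restricted Grassmannian -/

variable (Hp) in
/-- The set of partial isometries `u` with initial and final projectors `u*u`, `uu*` in the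
restricted Grassmannian. -/
@[ext]
structure URes where
  op : H →L[ℂ] H
  isStarProjection_source : IsStarProjection (star op * op)
  isStarProjection_target : IsStarProjection (op * star op)
  source_mem : (star op * op).range ∈ restrictedSubspaces Hp
  target_mem : (op * star op).range ∈ restrictedSubspaces Hp

namespace URes

/-- The source `u*u`. -/
def src (u : URes Hp) : GrRes Hp := ⟨star u.op * u.op, u.isStarProjection_source, u.source_mem⟩

/-- The target `uu*`. -/
def tgt (u : URes Hp) : GrRes Hp := ⟨u.op * star u.op, u.isStarProjection_target, u.target_mem⟩

theorem star_mul_mul (z : {z : URes Hp × URes Hp // src z.1 = tgt z.2}) :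
    star (z.1.1.op * z.1.2.op) * (z.1.1.op * z.1.2.op) = star z.1.2.op * z.1.2.op := by
  have h : star z.1.1.op * z.1.1.op = z.1.2.op * star z.1.2.op := congrArg GrRes.proj z.2
  rw [star_mul, mul_assoc, ← mul_assoc (star z.1.1.op), h, mul_assoc, ← mul_assoc]
  exact z.1.2.isStarProjection_source.isIdempotentElem

theorem mul_mul_star (z : {z : URes Hp × URes Hp // src z.1 = tgt z.2}) :
    (z.1.1.op * z.1.2.op) * star (z.1.1.op * z.1.2.op) = z.1.1.op * star z.1.1.op := by
  have h : star z.1.1.op * z.1.1.op = z.1.2.op * star z.1.2.op := congrArg GrRes.proj z.2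
  rw [star_mul, mul_assoc, ← mul_assoc z.1.2.op, ← h, mul_assoc, ← mul_assoc]
  exact z.1.1.isStarProjection_target.isIdempotentElem

/-- The multiplication `(u₁, u₂) ↦ u₁u₂`, defined for `u₁*u₁ = u₂u₂*`. -/
def mul (z : {z : URes Hp × URes Hp // src z.1 = tgt z.2}) : URes Hp where
  op := z.1.1.op * z.1.2.op
  isStarProjection_source := by
    rw [star_mul_mul]
    exact z.1.2.isStarProjection_source
  isStarProjection_target := by
    rw [mul_mul_star]
    exact z.1.1.isStarProjection_target
  source_mem := by
    rw [star_mul_mul]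
    exact z.1.2.source_mem
  target_mem := by
    rw [mul_mul_star]
    exact z.1.1.target_mem

/-- The identity section `p ↦ p`. -/
def unit (p : GrRes Hp) : URes Hp :=
  have h₁ : star p.proj * p.proj = p.proj := by
    rw [p.isStarProjection.isSelfAdjoint.star_eq]
    exact p.isStarProjection.isIdempotentElem
  have h₂ : p.proj * star p.proj = p.proj := by
    rw [p.isStarProjection.isSelfAdjoint.star_eq]
    exact p.isStarProjection.isIdempotentElem
  { op := p.proj
    isStarProjection_source := h₁.symm ▸ p.isStarProjection
    isStarProjection_target := h₂.symm ▸ p.isStarProjection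
    source_mem := h₁.symm ▸ p.range_mem
    target_mem := h₂.symm ▸ p.range_mem }

/-- The inversion `u ↦ u*`. -/
def inv (u : URes Hp) : URes Hp where
  op := star u.op
  isStarProjection_source := by
    rw [star_star]
    exact u.isStarProjection_target
  isStarProjection_target := by
    rw [star_star]
    exact u.isStarProjection_source
  source_mem := by
    rw [star_star]
    exact u.target_mem
  target_mem := by
    rw [star_star]
    exact u.source_mem

end URes

/-! ### Local cross sections -/

variable (Hp) in
/-- The commutator `[X, P₊]`. -/
def commPlus (X : H →L[ℂ] H) : H →L[ℂ] H := X * Hp.starProjection - Hp.starProjection * X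

variable (Hp) in
/-- The restricted unitary group: unitary operators `u` on `H` with `[u, P₊]` Hilbert–Schmidt. -/
def unitaryRes : Set (H →L[ℂ] H) :=
  {X | X ∈ unitary (H →L[ℂ] H) ∧ IsHilbertSchmidt (commPlus Hp X)}

variable (Hp) in
/-- A smooth local cross section `σ : Ω → U_res` of the map `g ↦ g H₊`, on an open neighbourhood `Ω`
of a point `W` of the restricted Grassmannian that is contained in the domain of the chart `φ_W`.

The Banach Lie group `U_res` is a submanifold of the Banach algebra of all `X` with `[X, P₊]`
Hilbert–Schmidt, normed by `‖X‖ + ‖[X, P₊]‖₂`; a map `σ` to it is smooth if and only if `σ` is smooth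
for the operator norm and `[σ, P₊]` is smooth for the Hilbert–Schmidt norm. -/
structure LocalSection where
  base : GrRes Hp
  domain : Set (GrRes Hp)
  base_mem : base ∈ domain
  isOpen_domain : IsOpen[atlasTopology (grAtlas Hp)] domain
  domain_subset : domain ⊆ base.chart.source
  toFun : GrRes Hp → (H →L[ℂ] H)
  mem_unitaryRes : ∀ p ∈ domain, toFun p ∈ unitaryRes Hp
  map_eq : ∀ p ∈ domain, Hp.map (toFun p).toLinearMap = p.space
  contDiffOn : ∀ c ∈ grAtlas Hp,
    ContDiffOn ℝ ∞ (c.pull toFun) (c.toFun '' (c.source ∩ domain))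
  contDiffOn_comm : ∀ c ∈ grAtlas Hp,
    ContDiffOn ℝ ∞ (c.pull fun p => HS.ofCLM (commPlus Hp (toFun p)))
      (c.toFun '' (c.source ∩ domain))

/-! ### The manifold structure on the set of partial isometries -/

namespace URes

/-- The operator `σ_γ(uu*)⁻¹ u σ_β(u*u)|_{H₊}` on `H₊`. -/
def reduced (b g : LocalSection Hp) (u : URes Hp) : Hp →L[ℂ] Hp :=
  Hp.orthogonalProjectionOnto ∘L (star (g.toFun u.tgt) * u.op * b.toFun u.src) ∘L Hp.subtypeL

/-- The domain `Ω_{αβγ}`. -/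
def chartSource (a : UnitaryChart Hp) (b g : LocalSection Hp) : Set (URes Hp) :=
  {u | u.src ∈ b.domain ∧ u.tgt ∈ g.domain ∧ reduced b g u ∈ a.source}

/-- The map `Φ_{αβγ}`. -/
def coord (a : UnitaryChart Hp) (b g : LocalSection Hp) (u : URes Hp) :
    HS g.base.space g.base.spaceᗮ × HS b.base.space b.base.spaceᗮ × SkewOp Hp :=
  (g.base.coord u.tgt, b.base.coord u.src, a.toFun (reduced b g u))

/-- The chart `(Ω_{αβγ}, Φ_{αβγ})`. -/
def chart (a : UnitaryChart Hp) (b g : LocalSection Hp) : BanachChart (URes Hp) where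
  E := HS g.base.space g.base.spaceᗮ × HS b.base.space b.base.spaceᗮ × SkewOp Hp
  source := chartSource a b g
  toFun := coord a b g

/-- The atlas obtained from a family of charts of `U₊` and a family of local cross sections. -/
def atlas (A : Set (UnitaryChart Hp)) (S : Set (LocalSection Hp)) : Set (BanachChart (URes Hp)) :=
  {c | ∃ a ∈ A, ∃ b ∈ S, ∃ g ∈ S, c = chart a b g}

end URes

end Restricted

end

end RestrictedGroupoid

open RestrictedGroupoid

/-!
A local cross section `σ` identifies each subspace `W` of its domain with `H₊`. Through two local
cross sections a partial isometry `u` therefore corresponds to the triple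
`(uu*, u*u, σ(uu*)⁻¹ u σ(u*u))` in `Gr_res × Gr_res × U₊`, which turns the adjoint and the product
of partial isometries into the inversion and the multiplication of `U₊`: locally the groupoid is the
product of a pair groupoid with the group `U₊`.

To construct local cross sections near `W`, let `2θ` be the angle operator from `W` to a nearby
subspace, the graph of `tan 2θ = 2A (1 - A*A)⁻¹` with `A = tan θ`. The Cayley transform of `A - A*`
is a unitary operator which maps `W` onto this graph, and by the inverse function theorem `A` is a
smooth function of `tan 2θ`. It remains to precede this unitary operator by a fixed element of
`U_res` which maps `H₊` onto `W`.
-/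

namespace RestrictedGroupoid

noncomputable section

/-! ### Hilbert–Schmidt and Fredholm operators -/

section Orthonormal

variable {𝕜 E : Type*} [RCLike 𝕜] [NormedAddCommGroup E] [InnerProductSpace 𝕜 E]

theorem enorm_sq_eq_tsum_inner {ι : Type*} (b : HilbertBasis ι 𝕜 E) (x : E) :
    ‖x‖ₑ ^ (2 : ℝ) = ∑' i, ‖⟪b i, x⟫_𝕜‖ₑ ^ (2 : ℝ) := by
  have hsum : HasSum (fun i => ‖⟪b i, x⟫_𝕜‖ ^ 2) (‖x‖ ^ 2) := by
    convert! RCLike.hasSum_re 𝕜 (b.hasSum_inner_mul_inner x x) using 1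
    · ext i
      have h := inner_mul_symm_re_eq_norm (𝕜 := 𝕜) x (b i)
      rw [norm_mul, norm_inner_symm, ← sq] at h
      exact h.symm
    · exact (inner_self_eq_norm_sq (𝕜 := 𝕜) x).symm
  simp only [ENNReal.rpow_ofNat, ← ofReal_norm, ← ENNReal.ofReal_pow (norm_nonneg _)]
  rw [← ENNReal.ofReal_tsum_of_nonneg (fun _ => by positivity) hsum.summable, hsum.tsum_eq]

theorem countable_of_orthonormal [TopologicalSpace.SeparableSpace E] {ι : Type*} {v : ι → E}
    (hv : Orthonormal 𝕜 v) : Countable ι := by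
  refine Pairwise.countable_of_isOpen_disjoint (s := fun i => Metric.ball (v i) (1 / 2))
    (fun i j hij => Metric.ball_disjoint_ball ?_) (fun i => Metric.isOpen_ball)
    (fun i => ⟨v i, Metric.mem_ball_self (by norm_num)⟩)
  have hdist : ‖v i - v j‖ ^ 2 = 2 := by
    rw [@norm_sub_sq 𝕜, hv.1 i, hv.1 j, hv.2 hij]
    norm_num
  rw [dist_eq_norm]
  nlinarith [norm_nonneg (v i - v j)]

theorem exists_hilbertBasis_nat [CompleteSpace E] [TopologicalSpace.SeparableSpace E]
    (hE : ¬ FiniteDimensional 𝕜 E) : Nonempty (HilbertBasis ℕ 𝕜 E) := by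
  obtain ⟨w, b, -⟩ := exists_hilbertBasis 𝕜 E
  have : Countable w := countable_of_orthonormal b.orthonormal
  have : Infinite w := by
    by_contra hfin
    rw [not_infinite_iff_finite] at hfin
    have := Fintype.ofFinite w
    exact hE b.toOrthonormalBasis.toBasis.finiteDimensional_of_finite
  obtain ⟨e⟩ := nonempty_equiv_of_countable (α := ℕ) (β := w)
  refine ⟨HilbertBasis.mk (v := b ∘ e) (b.orthonormal.comp _ e.injective) ?_⟩
  rw [e.surjective.range_comp]
  exact b.dense_span.ge

theorem nonempty_linearIsometryEquiv [CompleteSpace E] [TopologicalSpace.SeparableSpace E]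
    {F : Type*} [NormedAddCommGroup F] [InnerProductSpace 𝕜 F] [CompleteSpace F]
    [TopologicalSpace.SeparableSpace F] (hE : ¬ FiniteDimensional 𝕜 E)
    (hF : ¬ FiniteDimensional 𝕜 F) : Nonempty (E ≃ₗᵢ[𝕜] F) := by
  obtain ⟨b⟩ := exists_hilbertBasis_nat hE
  obtain ⟨c⟩ := exists_hilbertBasis_nat hF
  exact ⟨b.repr.trans c.repr.symm⟩

end Orthonormal

section HilbertSchmidtIdeal

variable {E F G : Type u} [NormedAddCommGroup E] [InnerProductSpace ℂ E]
  [NormedAddCommGroup F] [InnerProductSpace ℂ F] [NormedAddCommGroup G] [InnerProductSpace ℂ G]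

theorem hsENorm_comp_le_enorm_mul (S : F →L[ℂ] G) (T : E →L[ℂ] F) :
    hsENorm (S ∘L T) ≤ ‖S‖ₑ * hsENorm T := by
  refine hsENorm_le fun n e he => ?_
  calc (∑ i, ‖(S ∘L T) (e i)‖ₑ ^ (2 : ℝ)) ^ (1 / (2 : ℝ))
      ≤ (∑ i, (‖S‖ₑ * ‖T (e i)‖ₑ) ^ (2 : ℝ)) ^ (1 / (2 : ℝ)) := by
        gcongr with i
        exact S.le_opENorm _
    _ = ‖S‖ₑ * (∑ i, ‖T (e i)‖ₑ ^ (2 : ℝ)) ^ (1 / (2 : ℝ)) := by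
        simp_rw [ENNReal.mul_rpow_of_nonneg _ _ (zero_le_two (α := ℝ))]
        rw [← Finset.mul_sum, ENNReal.mul_rpow_of_nonneg _ _ one_half_pos.le, ← ENNReal.rpow_mul,
          mul_one_div_cancel two_ne_zero, ENNReal.rpow_one]
    _ ≤ ‖S‖ₑ * hsENorm T := by
        gcongr
        exact le_hsENorm T he

theorem IsHilbertSchmidt.comp_left {T : E →L[ℂ] F} (hT : IsHilbertSchmidt T) (S : F →L[ℂ] G) :
    IsHilbertSchmidt (S ∘L T) :=
  ne_top_of_le_ne_top (ENNReal.mul_ne_top enorm_ne_top hT) (hsENorm_comp_le_enorm_mul S T)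

theorem isHilbertSchmidt_zero : IsHilbertSchmidt (0 : E →L[ℂ] F) :=
  (hilbertSchmidt E F).zero_mem

theorem IsHilbertSchmidt.add {S T : E →L[ℂ] F} (hS : IsHilbertSchmidt S)
    (hT : IsHilbertSchmidt T) : IsHilbertSchmidt (S + T) :=
  (hilbertSchmidt E F).add_mem hS hT

theorem IsHilbertSchmidt.sub {S T : E →L[ℂ] F} (hS : IsHilbertSchmidt S)
    (hT : IsHilbertSchmidt T) : IsHilbertSchmidt (S - T) :=
  (hilbertSchmidt E F).sub_mem hS hT

theorem IsHilbertSchmidt.neg {S : E →L[ℂ] F} (hS : IsHilbertSchmidt S) :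
    IsHilbertSchmidt (-S) :=
  (hilbertSchmidt E F).neg_mem hS

theorem norm_le_toReal_hsENorm {T : E →L[ℂ] F} (hT : IsHilbertSchmidt T) :
    ‖T‖ ≤ (hsENorm T).toReal :=
  T.opNorm_le_bound ENNReal.toReal_nonneg (norm_apply_le hT)

variable [CompleteSpace E] [CompleteSpace F] [CompleteSpace G]

theorem hsENorm_adjoint (T : E →L[ℂ] F) : hsENorm T.adjoint = hsENorm T := by
  obtain ⟨_, b, -⟩ := exists_hilbertBasis ℂ E
  obtain ⟨_, c, -⟩ := exists_hilbertBasis ℂ F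
  rw [hsENorm_eq_tsum b, hsENorm_eq_tsum c]
  congr 1
  simp_rw [enorm_sq_eq_tsum_inner b, enorm_sq_eq_tsum_inner c]
  rw [ENNReal.tsum_comm]
  refine tsum_congr fun i => tsum_congr fun j => ?_
  rw [ContinuousLinearMap.adjoint_inner_right, ← ofReal_norm, ← ofReal_norm, norm_inner_symm]

theorem hsENorm_comp_le_mul_enorm (T : F →L[ℂ] G) (S : E →L[ℂ] F) :
    hsENorm (T ∘L S) ≤ hsENorm T * ‖S‖ₑ := by
  calc hsENorm (T ∘L S) = hsENorm (S.adjoint ∘L T.adjoint) := by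
        rw [← hsENorm_adjoint, ContinuousLinearMap.adjoint_comp]
    _ ≤ ‖S.adjoint‖ₑ * hsENorm T.adjoint := hsENorm_comp_le_enorm_mul _ _
    _ = hsENorm T * ‖S‖ₑ := by
        rw [hsENorm_adjoint, ← ofReal_norm, LinearIsometryEquiv.norm_map, ofReal_norm, mul_comm]

theorem IsHilbertSchmidt.comp_right {T : F →L[ℂ] G} (hT : IsHilbertSchmidt T) (S : E →L[ℂ] F) :
    IsHilbertSchmidt (T ∘L S) :=
  ne_top_of_le_ne_top (ENNReal.mul_ne_top hT enorm_ne_top) (hsENorm_comp_le_mul_enorm T S)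

theorem IsHilbertSchmidt.adjoint {T : E →L[ℂ] F} (hT : IsHilbertSchmidt T) :
    IsHilbertSchmidt T.adjoint := by
  rwa [IsHilbertSchmidt, hsENorm_adjoint]

theorem IsHilbertSchmidt.tsum_ne_top {ι : Type*} (b : HilbertBasis ι ℂ E) {T : E →L[ℂ] F}
    (hT : IsHilbertSchmidt T) : ∑' i, ‖T (b i)‖ₑ ^ (2 : ℝ) ≠ ⊤ := by
  rwa [IsHilbertSchmidt, hsENorm_eq_tsum b, one_div, Ne,
    ENNReal.rpow_eq_top_iff_of_pos (by norm_num)] at hT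

theorem isHilbertSchmidt_of_finiteDimensional [FiniteDimensional ℂ E] (T : E →L[ℂ] F) :
    IsHilbertSchmidt T := by
  rw [IsHilbertSchmidt, hsENorm_eq_tsum (stdOrthonormalBasis ℂ E).toHilbertBasis, tsum_fintype]
  exact ENNReal.rpow_ne_top_of_nonneg (by norm_num) <| ENNReal.sum_ne_top.2 fun i _ =>
    ENNReal.rpow_ne_top_of_nonneg zero_le_two enorm_ne_top

theorem isHilbertSchmidt_of_finiteRange {T : E →L[ℂ] F} [FiniteDimensional ℂ T.range] :
    IsHilbertSchmidt T :=
  (isHilbertSchmidt_of_finiteDimensional T.range.subtypeL).comp_right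
    (T.codRestrict T.range fun x => ⟨x, rfl⟩)

theorem finiteDimensional_of_isHilbertSchmidt_id
    (h : IsHilbertSchmidt (ContinuousLinearMap.id ℂ E)) : FiniteDimensional ℂ E := by
  obtain ⟨w, b, -⟩ := exists_hilbertBasis ℂ E
  have hw : Finite w := by
    by_contra hinf
    rw [not_finite_iff_infinite] at hinf
    refine h.tsum_ne_top b ?_
    simp [← ofReal_norm, b.orthonormal.1]
  have := Fintype.ofFinite w
  exact b.toOrthonormalBasis.toBasis.finiteDimensional_of_finite

theorem IsHilbertSchmidt.exists_finiteRange_hsENorm_sub_lt {T : E →L[ℂ] F}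
    (hT : IsHilbertSchmidt T) {ε : ℝ≥0∞} (hε : 0 < ε) :
    ∃ R : E →L[ℂ] F, R.toLinearMap.HasFiniteRange ∧ hsENorm (T - R) < ε := by
  obtain ⟨w, b, -⟩ := exists_hilbertBasis ℂ E
  obtain ⟨s, hs⟩ := ((ENNReal.tendsto_tsum_compl_atTop_zero (hT.tsum_ne_top b)).eventually_lt_const
    (ENNReal.rpow_pos_of_nonneg hε (zero_le_two (α := ℝ)))).exists
  let K : Submodule ℂ E := Submodule.span ℂ (b '' s)
  have : FiniteDimensional ℂ K := .span_of_finite ℂ (s.finite_toSet.image b)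
  refine ⟨T ∘L K.starProjection, ?_, ?_⟩
  · have : FiniteDimensional ℂ K.starProjection.range := by
      rwa [Submodule.range_starProjection]
    exact (LinearMap.hasFiniteRange_iff_range.2
      ((Submodule.fg_iff_finiteDimensional _).2 this)).comp_left T.toLinearMap
  have hmem {i : w} (hi : i ∈ s) : (T - T ∘L K.starProjection) (b i) = 0 := by
    have hbK : b i ∈ K := Submodule.subset_span ⟨i, hi, rfl⟩
    simp [Submodule.starProjection_eq_self_iff.2 hbK]
  have hnotMem {i : w} (hi : i ∉ s) : (T - T ∘L K.starProjection) (b i) = T (b i) := by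
    have hbK : b i ∈ Kᗮ := by
      refine Submodule.isOrtho_span (s := {b i}).2 ?_ (Submodule.mem_span_singleton_self _)
      rintro _ rfl _ ⟨j, hj, rfl⟩
      exact b.orthonormal.2 fun hij => hi (hij ▸ hj)
    simp [(Submodule.starProjection_apply_eq_zero_iff K).2 hbK]
  have htail : ∑' i, ‖(T - T ∘L K.starProjection) (b i)‖ₑ ^ (2 : ℝ)
      = ∑' i : {i // i ∉ s}, ‖T (b i)‖ₑ ^ (2 : ℝ) := by
    refine Eq.trans (tsum_congr fun i => ?_)
      (tsum_subtype {i | i ∉ s} fun i => ‖T (b i)‖ₑ ^ (2 : ℝ)).symm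
    by_cases hi : i ∈ s
    · simp [hmem hi, hi]
    · simp [hnotMem hi, hi]
  rw [hsENorm_eq_tsum b, htail, one_div]
  exact ENNReal.rpow_inv_lt_iff two_pos |>.2 hs

end HilbertSchmidtIdeal

namespace HS

variable {E F G : Type u} [NormedAddCommGroup E] [InnerProductSpace ℂ E]
  [NormedAddCommGroup F] [InnerProductSpace ℂ F] [NormedAddCommGroup G] [InnerProductSpace ℂ G]

/-- A Hilbert–Schmidt operator as an element of `L²(E, F)`. -/
def mk (T : E →L[ℂ] F) (hT : IsHilbertSchmidt T) : HS E F :=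
  (⟨T, hT⟩ : ↥(hilbertSchmidt E F))

theorem toCLM_ofCLM {T : E →L[ℂ] F} (hT : IsHilbertSchmidt T) : toCLM (ofCLM T) = T :=
  congrArg toCLM (show ofCLM T = mk T hT from dif_pos (c := T ∈ hilbertSchmidt E F) hT)

theorem ofCLM_toCLM (T : HS E F) : ofCLM (toCLM T) = T :=
  toCLM_injective (toCLM_ofCLM T.isHilbertSchmidt)

theorem contDiff_toCLM {n : WithTop ℕ∞} : ContDiff ℝ n fun T : HS E F => toCLM T :=
  (ContinuousLinearMap.contDiff <| toCLM.mkContinuous 1 fun T : HS E F => by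
    rw [one_mul]
    exact norm_le_toReal_hsENorm T.isHilbertSchmidt).restrict_scalars ℝ

variable (E F G) in
/-- Composition of a Hilbert–Schmidt operator with a bounded operator on the left. -/
def compLeft : (F →L[ℂ] G) →L[ℂ] HS E F →L[ℂ] HS E G :=
  LinearMap.mkContinuous₂
    (LinearMap.mk₂ ℂ (fun S T => mk (S ∘L toCLM T) (T.isHilbertSchmidt.comp_left S))
      (fun _ _ _ => toCLM_injective (ContinuousLinearMap.add_comp _ _ _))
      (fun _ _ _ => toCLM_injective (ContinuousLinearMap.smul_comp _ _ _))
      (fun _ _ _ => toCLM_injective (ContinuousLinearMap.comp_add _ _ _))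
      (fun _ _ _ => toCLM_injective (ContinuousLinearMap.comp_smul _ _ _))) 1 fun S T => by
    rw [one_mul]
    have h := ENNReal.toReal_mono (ENNReal.mul_ne_top enorm_ne_top T.isHilbertSchmidt)
      (hsENorm_comp_le_enorm_mul S (toCLM T))
    rwa [ENNReal.toReal_mul, toReal_enorm] at h

@[simp] theorem toCLM_compLeft (S : F →L[ℂ] G) (T : HS E F) :
    toCLM (compLeft E F G S T) = S ∘L toCLM T := rfl

variable [CompleteSpace E] [CompleteSpace F] [CompleteSpace G]

variable (E F G) in
/-- Composition of a Hilbert–Schmidt operator with a bounded operator on the right. -/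
def compRight : HS F G →L[ℂ] (E →L[ℂ] F) →L[ℂ] HS E G :=
  LinearMap.mkContinuous₂
    (LinearMap.mk₂ ℂ (fun T S => mk (toCLM T ∘L S) (T.isHilbertSchmidt.comp_right S))
      (fun _ _ _ => toCLM_injective (ContinuousLinearMap.add_comp _ _ _))
      (fun _ _ _ => toCLM_injective (ContinuousLinearMap.smul_comp _ _ _))
      (fun _ _ _ => toCLM_injective (ContinuousLinearMap.comp_add _ _ _))
      (fun _ _ _ => toCLM_injective (ContinuousLinearMap.comp_smul _ _ _))) 1 fun T S => by
    rw [one_mul]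
    have h := ENNReal.toReal_mono (ENNReal.mul_ne_top T.isHilbertSchmidt enorm_ne_top)
      (hsENorm_comp_le_mul_enorm (toCLM T) S)
    rwa [ENNReal.toReal_mul, toReal_enorm] at h

@[simp] theorem toCLM_compRight (T : HS F G) (S : E →L[ℂ] F) :
    toCLM (compRight E F G T S) = toCLM T ∘L S := rfl

variable (E F) in
/-- The adjoint of Hilbert–Schmidt operators, as a real-linear map. -/
def adjointL : HS E F →L[ℝ] HS F E :=
  LinearMap.mkContinuous
    { toFun := fun T => mk (toCLM T).adjoint T.isHilbertSchmidt.adjoint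
      map_add' := fun S T => toCLM_injective (map_add ContinuousLinearMap.adjoint _ _)
      map_smul' := fun c T => toCLM_injective (by
        change ContinuousLinearMap.adjoint ((c : ℂ) • toCLM T) =
          (c : ℂ) • ContinuousLinearMap.adjoint (toCLM T)
        rw [map_smulₛₗ, Complex.conj_ofReal]) } 1 fun T => by
    rw [one_mul]
    exact (congrArg ENNReal.toReal (hsENorm_adjoint (toCLM T))).le

@[simp] theorem toCLM_adjointL (T : HS E F) :
    toCLM (adjointL E F T) = ContinuousLinearMap.adjoint (toCLM T) := rfl

end HS

section Fredholm

variable {𝕜 E F G : Type*} [NontriviallyNormedField 𝕜] [CompleteSpace 𝕜]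
  [NormedAddCommGroup E] [NormedSpace 𝕜 E] [NormedAddCommGroup F] [NormedSpace 𝕜 F]
  [NormedAddCommGroup G] [NormedSpace 𝕜 G]

theorem isFredholm_equiv (e : E ≃L[𝕜] F) : (e : E →L[𝕜] F).IsFredholm :=
  .of_isQuasiInverse (v := (e.symm : F →L[𝕜] E)) e.toLinearEquiv.isQuasiInverse

theorem isFredholm_comp {S : F →L[𝕜] G} {T : E →L[𝕜] F} (hS : S.IsFredholm) (hT : T.IsFredholm) :
    (S ∘L T).IsFredholm := by
  obtain ⟨P, hP⟩ := hS.exists_isQuasiInverse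
  obtain ⟨Q, hQ⟩ := hT.exists_isQuasiInverse
  exact .of_isQuasiInverse (v := Q ∘L P) (hQ.comp hP)

open scoped LinearMap.FiniteRangeSetoid in
theorem isFredholm_add_of_forall_exists_finiteRange [CompleteSpace E] {T K : E →L[𝕜] F}
    (hT : T.IsFredholm)
    (hK : ∀ ε > 0, ∃ R : E →L[𝕜] F, R.toLinearMap.HasFiniteRange ∧ ‖K - R‖ < ε) :
    (T + K).IsFredholm := by
  obtain ⟨Q, hQ⟩ := hT.exists_isQuasiInverse
  obtain ⟨R, hR, hKR⟩ := hK (‖Q‖ + 1)⁻¹ (by positivity)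
  have hsmall : ‖-(Q ∘L (K - R))‖ < 1 := by
    rw [norm_neg]
    calc ‖Q ∘L (K - R)‖ ≤ ‖Q‖ * ‖K - R‖ := Q.opNorm_comp_le _
      _ ≤ ‖Q‖ * (‖Q‖ + 1)⁻¹ := by gcongr
      _ < 1 := by
        rw [← div_eq_mul_inv, div_lt_one (by positivity)]
        exact lt_add_one _
  obtain ⟨e, he⟩ : ∃ e : E ≃L[𝕜] E, (e : E →L[𝕜] E) = .id 𝕜 E + Q ∘L (K - R) := by
    obtain ⟨x, hx⟩ := isUnit_one_sub_of_norm_lt_one hsmall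
    exact ⟨.ofUnit x, hx.trans (sub_neg_eq_add _ _)⟩
  have hequiv : Q.toLinearMap ∘ₗ (T + K).toLinearMap ≈ (e : E →L[𝕜] E).toLinearMap := by
    rw [LinearMap.FiniteRangeSetoid.equiv_iff_hasFiniteRange]
    have hdiff : Q.toLinearMap ∘ₗ (T + K).toLinearMap - (e : E →L[𝕜] E).toLinearMap =
        (Q.toLinearMap ∘ₗ T.toLinearMap - .id) + Q.toLinearMap ∘ₗ R.toLinearMap := by
      ext x
      simp only [he, LinearMap.sub_apply, LinearMap.add_apply, LinearMap.comp_apply,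
        LinearMap.id_apply, ContinuousLinearMap.coe_coe, ContinuousLinearMap.comp_apply, add_apply,
        sub_apply, ContinuousLinearMap.id_apply, map_add, map_sub]
      abel
    rw [hdiff]
    exact (LinearMap.FiniteRangeSetoid.equiv_iff_hasFiniteRange.1 hQ.1).add (hR.comp_left _)
  refine .of_isQuasiInverse (v := (e.symm : E →L[𝕜] E) ∘L Q) ?_
  exact .of_comp_right hQ.symm (e.toLinearEquiv.isQuasiInverse.congr (Setoid.refl _) hequiv)

theorem isFredholm_add_isHilbertSchmidt {E F : Type u} [NormedAddCommGroup E]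
    [InnerProductSpace ℂ E] [CompleteSpace E] [NormedAddCommGroup F] [InnerProductSpace ℂ F]
    [CompleteSpace F] {T K : E →L[ℂ] F} (hT : T.IsFredholm) (hK : IsHilbertSchmidt K) :
    (T + K).IsFredholm := by
  refine isFredholm_add_of_forall_exists_finiteRange hT fun ε hε => ?_
  obtain ⟨R, hR, hKR⟩ := hK.exists_finiteRange_hsENorm_sub_lt (ENNReal.ofReal_pos.2 hε)
  exact ⟨R, hR, (norm_le_toReal_hsENorm hKR.ne_top).trans_lt
    (ENNReal.toReal_lt_of_lt_ofReal hKR)⟩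

theorem isHilbertSchmidt_of_comp_isFredholm {E F G : Type u} [NormedAddCommGroup E]
    [InnerProductSpace ℂ E] [CompleteSpace E] [NormedAddCommGroup F] [InnerProductSpace ℂ F]
    [CompleteSpace F] [NormedAddCommGroup G] [InnerProductSpace ℂ G] [CompleteSpace G]
    {N : F →L[ℂ] G} {T : E →L[ℂ] F} (hT : T.IsFredholm) (hNT : IsHilbertSchmidt (N ∘L T)) :
    IsHilbertSchmidt N := by
  obtain ⟨Q, -, hQ⟩ := hT.exists_isQuasiInverse
  have hR : FiniteDimensional ℂ (T ∘L Q - .id ℂ F).range :=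
    (Submodule.fg_iff_finiteDimensional _).1 (LinearMap.hasFiniteRange_iff_range.1
      (LinearMap.FiniteRangeSetoid.equiv_iff_hasFiniteRange.1 hQ))
  have hN : N = (N ∘L T) ∘L Q - N ∘L (T ∘L Q - .id ℂ F) := by
    ext x
    simp
  rw [hN]
  exact (hNT.comp_right Q).sub (isHilbertSchmidt_of_finiteRange.comp_left N)

end Fredholm

section OperatorCalculus

variable {Y : Type*} [NormedAddCommGroup Y] [NormedSpace ℝ Y] {n : WithTop ℕ∞} {y : Y}

section Bilinear

variable {E₁ E₂ E₃ : Type*} [NormedAddCommGroup E₁] [NormedSpace ℂ E₁]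
  [NormedAddCommGroup E₂] [NormedSpace ℂ E₂] [NormedAddCommGroup E₃] [NormedSpace ℂ E₃]
  (B : E₁ →L[ℂ] E₂ →L[ℂ] E₃) {f : Y → E₁} {g : Y → E₂}

theorem contDiffAt_bilinear (hf : ContDiffAt ℝ n f y) (hg : ContDiffAt ℝ n g y) :
    ContDiffAt ℝ n (fun y => B (f y) (g y)) y :=
  (B.isBoundedBilinearMap.contDiff.restrict_scalars ℝ).contDiffAt.comp y (hf.prodMk hg)

theorem hasFDerivAt_bilinear {f' : Y →L[ℝ] E₁} {g' : Y →L[ℝ] E₂} (hf : HasFDerivAt f f' y)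
    (hg : HasFDerivAt g g' y) :
    HasFDerivAt (fun y => B (f y) (g y)) ((B (f y)).restrictScalars ℝ ∘L g' +
      (B.flip (g y)).restrictScalars ℝ ∘L f') y := by
  have hB := (B.isBoundedBilinearMap.hasFDerivAt (f y, g y)).restrictScalars ℝ
  refine (HasFDerivAt.comp (g := fun p : E₁ × E₂ => B p.1 p.2) y hB
    (hf.prodMk hg)).congr_fderiv ?_
  ext
  simp

theorem contDiffAt_comp {f : Y → E₂ →L[ℂ] E₃} {g : Y → E₁ →L[ℂ] E₂} (hf : ContDiffAt ℝ n f y)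
    (hg : ContDiffAt ℝ n g y) : ContDiffAt ℝ n (fun y => f y ∘L g y) y :=
  contDiffAt_bilinear (ContinuousLinearMap.compL ℂ E₁ E₂ E₃) hf hg

end Bilinear

section NormedAlgebra

variable {R : Type*} [NormedRing R] [HasSummableGeomSeries R]

theorem contDiffAt_ringInverse_comp [NormedAlgebra ℝ R] {f : Y → R} (hf : ContDiffAt ℝ n f y)
    (hu : IsUnit (f y)) : ContDiffAt ℝ n (fun y => Ring.inverse (f y)) y := by
  obtain ⟨x, hx⟩ := hu
  exact (hx ▸ contDiffAt_ringInverse ℝ x : ContDiffAt ℝ n Ring.inverse (f y)).comp y hf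

theorem contDiffAt_star {A : Type*} [NormedAddCommGroup A] [StarAddMonoid A]
    [NormedStarGroup A] [NormedSpace ℝ A] [StarModule ℝ A] {f : Y → A}
    (hf : ContDiffAt ℝ n f y) : ContDiffAt ℝ n (fun y => star (f y)) y :=
  (ContinuousLinearEquiv.contDiff (𝕜 := ℝ) (starL' ℝ : A ≃L[ℝ] A)).contDiffAt.comp y hf

end NormedAlgebra

namespace HS

variable {E F G : Type u} [NormedAddCommGroup E] [InnerProductSpace ℂ E]
  [NormedAddCommGroup F] [InnerProductSpace ℂ F] [NormedAddCommGroup G] [InnerProductSpace ℂ G]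

theorem contDiffAt_compLeft {f : Y → F →L[ℂ] G} {g : Y → HS E F} (hf : ContDiffAt ℝ n f y)
    (hg : ContDiffAt ℝ n g y) : ContDiffAt ℝ n (fun y => compLeft E F G (f y) (g y)) y :=
  contDiffAt_bilinear (compLeft E F G) hf hg

variable [CompleteSpace E] [CompleteSpace F]

theorem contDiffAt_compRight [CompleteSpace G] {f : Y → HS F G} {g : Y → E →L[ℂ] F}
    (hf : ContDiffAt ℝ n f y) (hg : ContDiffAt ℝ n g y) :
    ContDiffAt ℝ n (fun y => compRight E F G (f y) (g y)) y :=
  contDiffAt_bilinear (compRight E F G) hf hg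

theorem contDiffAt_adjointL {f : Y → HS E F} (hf : ContDiffAt ℝ n f y) :
    ContDiffAt ℝ n (fun y => adjointL E F (f y)) y :=
  (ContinuousLinearMap.contDiff (𝕜 := ℝ) (adjointL E F)).contDiffAt.comp y hf

end HS

end OperatorCalculus

/-! ### Smooth maps into manifolds given by atlases -/

section Manifold

variable {M N : Type u} {𝒜 : Set (BanachChart M)} {ℬ : Set (BanachChart N)}
variable {Y : Type*} [NormedAddCommGroup Y] [NormedSpace ℝ Y] {D : Set Y} {v : Y → M}

/-- Smoothness of a map `v` from a subset `D` of a normed space to a set `M` with an atlas: the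
coordinates of `v` are smooth on open subsets of `Y`. In particular `D` is open if `𝒜` covers
`M`. -/
def SmoothInto (𝒜 : Set (BanachChart M)) (D : Set Y) (v : Y → M) : Prop :=
  ∀ d ∈ 𝒜, IsOpen (D ∩ v ⁻¹' d.source) ∧
    ContDiffOn ℝ ∞ (fun y => d.toFun (v y)) (D ∩ v ⁻¹' d.source)

theorem SmoothInto.congr {w : Y → M} (hv : SmoothInto 𝒜 D v) (hwv : Set.EqOn w v D) :
    SmoothInto 𝒜 D w := by
  intro d hd
  rw [hwv.inter_preimage_eq]
  exact ⟨(hv d hd).1, (hv d hd).2.congr fun y hy => congrArg d.toFun (hwv hy.1)⟩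

theorem SmoothInto.comp {Z : Type*} [NormedAddCommGroup Z] [NormedSpace ℝ Z]
    (hv : SmoothInto 𝒜 D v) {D' : Set Z} (hD' : IsOpen D') {f : Z → Y}
    (hf : ContDiffOn ℝ ∞ f D') (hfD : Set.MapsTo f D' D) : SmoothInto 𝒜 D' (v ∘ f) := by
  intro d hd
  have domain_eq : D' ∩ v ∘ f ⁻¹' d.source = D' ∩ f ⁻¹' (D ∩ v ⁻¹' d.source) := by
    ext z
    exact and_congr_right fun hz => (and_iff_right (hfD hz)).symm
  rw [domain_eq]
  exact ⟨hf.continuousOn.isOpen_inter_preimage hD' (hv d hd).1,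
    (hv d hd).2.comp (hf.mono Set.inter_subset_left) fun y hy => hy.2⟩

theorem isSmoothOnSubset_of_smoothInto {P : Type u} {𝒞 : Set (BanachChart P)}
    {S : M × N → Prop} {f : {z : M × N // S z} → P}
    (hf : ∀ c ∈ 𝒜, ∀ d ∈ ℬ, ∃ (D : Set (c.E × d.E)) (v : c.E × d.E → P), SmoothInto 𝒞 D v ∧
      ∀ w : {z : M × N // S z}, w.1.1 ∈ c.source → w.1.2 ∈ d.source →
        (c.toFun w.1.1, d.toFun w.1.2) ∈ D ∧ v (c.toFun w.1.1, d.toFun w.1.2) = f w) :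
    IsSmoothOnSubset 𝒜 ℬ 𝒞 f := by
  intro c hc d hd e he z hzc hzd hze
  obtain ⟨D, v, hv, hvf⟩ := hf c hc d hd
  refine ⟨D ∩ v ⁻¹' e.source, fun y => e.toFun (v y), (hv e he).1, ⟨(hvf z hzc hzd).1, ?_⟩,
    (hv e he).2, fun w hwc hwd hw => ?_⟩
  · rwa [Set.mem_preimage, (hvf z hzc hzd).2]
  · have hmem := hw.2
    rw [Set.mem_preimage, (hvf w hwc hwd).2] at hmem
    exact ⟨hmem, congrArg e.toFun (hvf w hwc hwd).2.symm⟩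

namespace BanachChart

variable {c : BanachChart M} {y : c.E} {x : M}

theorem pull_toFun (hc : Set.InjOn c.toFun c.source) {F : Type*} [Zero F] (f : M → F)
    (hx : x ∈ c.source) : c.pull f (c.toFun x) = f x := by
  have hex : ∃ z ∈ c.source, c.toFun z = c.toFun x := ⟨x, hx, rfl⟩
  rw [pull, dif_pos hex, hc hex.choose_spec.1 hx hex.choose_spec.2]

variable [Nonempty M]

/-- The inverse of a chart, with arbitrary values outside the image of the chart. -/
def inv (c : BanachChart M) : c.E → M := Function.invFunOn c.toFun c.source

theorem inv_mem (hy : y ∈ c.toFun '' c.source) : c.inv y ∈ c.source :=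
  Function.invFunOn_mem hy

theorem toFun_inv (hy : y ∈ c.toFun '' c.source) : c.toFun (c.inv y) = y :=
  Function.invFunOn_eq hy

theorem inv_toFun (hc : Set.InjOn c.toFun c.source) (hx : x ∈ c.source) :
    c.inv (c.toFun x) = x :=
  hc.leftInvOn_invFunOn hx

theorem pull_eq (hc : Set.InjOn c.toFun c.source) {F : Type*} [Zero F] (f : M → F)
    (hy : y ∈ c.toFun '' c.source) : c.pull f y = f (c.inv y) := by
  obtain ⟨x, hx, rfl⟩ := hy
  rw [pull_toFun hc f hx, inv_toFun hc hx]

theorem image_inter (hc : Set.InjOn c.toFun c.source) (P : Set M) :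
    c.toFun '' (c.source ∩ P) = c.toFun '' c.source ∩ c.inv ⁻¹' P := by
  ext y
  constructor
  · rintro ⟨x, ⟨hx, hxP⟩, rfl⟩
    exact ⟨⟨x, hx, rfl⟩, by rwa [Set.mem_preimage, inv_toFun hc hx]⟩
  · rintro ⟨hy, hyP⟩
    exact ⟨c.inv y, ⟨inv_mem hy, hyP⟩, toFun_inv hy⟩

end BanachChart

variable [Nonempty M]

/-- A smooth atlas, without the Hausdorff condition of `IsBanachManifold`; the transition maps are
phrased through the inverses of the charts. -/
structure IsSmoothAtlas (𝒜 : Set (BanachChart M)) : Prop where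
  injOn : ∀ c ∈ 𝒜, Set.InjOn c.toFun c.source
  cover : ∀ x : M, ∃ c ∈ 𝒜, x ∈ c.source
  smoothInto_inv : ∀ c ∈ 𝒜, SmoothInto 𝒜 (c.toFun '' c.source) c.inv

namespace IsSmoothAtlas

theorem isOpen_image (h : IsSmoothAtlas 𝒜) {c : BanachChart M} (hc : c ∈ 𝒜) :
    IsOpen (c.toFun '' c.source) := by
  have hopen := (h.smoothInto_inv c hc c hc).1
  rwa [← BanachChart.image_inter (h.injOn c hc), Set.inter_self] at hopen

theorem isOpen_image_inter (h : IsSmoothAtlas 𝒜) {U : Set M} (hU : IsOpen[atlasTopology 𝒜] U)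
    {c : BanachChart M} (hc : c ∈ 𝒜) : IsOpen (c.toFun '' (c.source ∩ U)) := by
  have hinj := h.injOn c hc
  rw [BanachChart.image_inter hinj]
  induction hU with
  | basic U hU =>
    obtain ⟨d, hd, O, hO, rfl⟩ := hU
    obtain ⟨hopen, hsmooth⟩ := h.smoothInto_inv c hc d hd
    rw [Set.preimage_inter, ← Set.inter_assoc]
    exact hsmooth.continuousOn.isOpen_inter_preimage hopen hO
  | univ => simpa using h.isOpen_image hc
  | inter U V _ _ hU hV =>
    rw [Set.preimage_inter, Set.inter_inter_distrib_left]
    exact hU.inter hV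
  | sUnion s _ hs =>
    rw [Set.preimage_sUnion, Set.inter_iUnion₂]
    exact isOpen_biUnion hs

theorem iUnion_source_inter_preimage_image (h : IsSmoothAtlas 𝒜) (U : Set M) :
    ⋃ c ∈ 𝒜, c.source ∩ c.toFun ⁻¹' (c.toFun '' (c.source ∩ U)) = U := by
  ext x
  simp only [Set.mem_iUnion]
  constructor
  · rintro ⟨c, hc, hxc, z, ⟨hzc, hz⟩, hzx⟩
    rwa [← h.injOn c hc hzc hxc hzx]
  · intro hx
    obtain ⟨c, hc, hxc⟩ := h.cover x
    exact ⟨c, hc, hxc, x, ⟨hxc, hx⟩, rfl⟩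

theorem isOpen_iff (h : IsSmoothAtlas 𝒜) {U : Set M} :
    IsOpen[atlasTopology 𝒜] U ↔ ∀ c ∈ 𝒜, IsOpen (c.toFun '' (c.source ∩ U)) := by
  refine ⟨fun hU c hc => h.isOpen_image_inter hU hc, fun hU => ?_⟩
  let _ : TopologicalSpace M := atlasTopology 𝒜
  rw [← h.iUnion_source_inter_preimage_image U]
  exact isOpen_biUnion fun c hc =>
    TopologicalSpace.isOpen_generateFrom_of_mem ⟨c, hc, _, hU c hc, rfl⟩

theorem isBanachManifold (h : IsSmoothAtlas 𝒜) {F : Type*} [TopologicalSpace F] [T2Space F]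
    {f : M → F} (hf : Function.Injective f)
    (hcont : ∀ c ∈ 𝒜, ContinuousOn (fun y => f (c.inv y)) (c.toFun '' c.source)) :
    IsBanachManifold 𝒜 where
  injOn := h.injOn
  cover := h.cover
  isOpen_image c hc d hd := by
    rw [BanachChart.image_inter (h.injOn c hc)]
    exact (h.smoothInto_inv c hc d hd).1
  contDiffOn c hc d hd := by
    rw [BanachChart.image_inter (h.injOn c hc)]
    exact (h.smoothInto_inv c hc d hd).2.congr fun y hy =>
      BanachChart.pull_eq (h.injOn c hc) _ hy.1
  t2 := by
    let _ : TopologicalSpace M := atlasTopology 𝒜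
    refine T2Space.of_injective_continuous hf (continuous_def.2 fun O hO => h.isOpen_iff.2 ?_)
    intro c hc
    rw [BanachChart.image_inter (h.injOn c hc)]
    exact (hcont c hc).isOpen_inter_preimage (h.isOpen_image hc) hO

theorem isSmoothMap (h : IsSmoothAtlas 𝒜) {f : M → N}
    (hf : ∀ c ∈ 𝒜, SmoothInto ℬ (c.toFun '' c.source) (fun y => f (c.inv y))) :
    IsSmoothMap 𝒜 ℬ f := by
  intro c hc d hd
  rw [BanachChart.image_inter (h.injOn c hc)]
  exact ⟨(hf c hc d hd).1, (hf c hc d hd).2.congr fun y hy =>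
      BanachChart.pull_eq (h.injOn c hc) _ hy.1⟩

theorem continuous (h : IsSmoothAtlas 𝒜) {f : M → N} (hf : IsSmoothMap 𝒜 ℬ f) :
    @Continuous M N (atlasTopology 𝒜) (atlasTopology ℬ) f := by
  let _ : TopologicalSpace M := atlasTopology 𝒜
  refine continuous_generateFrom_iff.2 ?_
  rintro _ ⟨d, hd, O, hO, rfl⟩
  refine h.isOpen_iff.2 fun c hc => ?_
  obtain ⟨hopen, hsmooth⟩ := hf c hc d hd
  convert hsmooth.continuousOn.isOpen_inter_preimage hopen hO using 1
  rw [BanachChart.image_inter (h.injOn c hc), BanachChart.image_inter (h.injOn c hc),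
    Set.preimage_inter, Set.preimage_inter, ← Set.inter_assoc]
  ext y
  refine and_congr_right fun hy => ?_
  simp only [Set.mem_preimage, BanachChart.pull_eq (h.injOn c hc) _ hy.1]

theorem isSubmersionMap [Nonempty N] (h : IsSmoothAtlas 𝒜) (hℬ : IsSmoothAtlas ℬ) {f : M → N}
    (hf : IsSmoothMap 𝒜 ℬ f)
    (hsection : ∀ x, ∃ (U : Set N) (τ : N → M), f x ∈ U ∧ τ (f x) = x ∧ (∀ p ∈ U, f (τ p) = p) ∧
      ∀ d ∈ ℬ, SmoothInto 𝒜 (d.toFun '' d.source ∩ d.inv ⁻¹' U) (τ ∘ d.inv)) :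
    IsSubmersionMap 𝒜 ℬ f := by
  refine ⟨hf, fun c hc d hd x hx hfx => ?_⟩
  obtain ⟨U, τ, hxU, hτx, hfτ, hτ⟩ := hsection x
  let φ : c.E → d.E := c.pull fun x => d.toFun (f x)
  let q : d.E → c.E := fun z => c.toFun (τ (d.inv z))
  have inv_fx : d.inv (d.toFun (f x)) = f x := BanachChart.inv_toFun (hℬ.injOn d hd) hfx
  have hqx : q (d.toFun (f x)) = c.toFun x := by simp only [q, inv_fx, hτx]
  have hnhds := (hτ d hd c hc).1.mem_nhds (x := d.toFun (f x))
    ⟨⟨⟨_, hfx, rfl⟩, by rwa [Set.mem_preimage, inv_fx]⟩, by simpa [inv_fx, hτx] using hx⟩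
  have hq : DifferentiableAt ℝ q (d.toFun (f x)) :=
    ((hτ d hd c hc).2.contDiffAt hnhds).differentiableAt (by simp)
  have hφ : DifferentiableAt ℝ φ (q (d.toFun (f x))) := by
    rw [hqx]
    exact ((hf c hc d hd).2.contDiffAt ((hf c hc d hd).1.mem_nhds
      ⟨x, ⟨hx, hfx⟩, rfl⟩)).differentiableAt (by simp)
  have hφq : φ ∘ q =ᶠ[𝓝 (d.toFun (f x))] id := by
    filter_upwards [hnhds] with z hz
    exact (BanachChart.pull_toFun (h.injOn c hc) (fun x => d.toFun (f x)) hz.2).trans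
      ((congrArg d.toFun (hfτ _ hz.1.2)).trans (BanachChart.toFun_inv hz.1.1))
  have hfderiv : fderiv ℝ φ (c.toFun x) ∘L fderiv ℝ q (d.toFun (f x)) = .id ℝ d.E := by
    rw [← hqx]
    exact (hφ.hasFDerivAt.comp _ hq.hasFDerivAt).unique
      ((hasFDerivAt_id (𝕜 := ℝ) (d.toFun (f x))).congr_of_eventuallyEq hφq)
  have hright : Function.RightInverse (fderiv ℝ q (d.toFun (f x))) (fderiv ℝ φ (c.toFun x)) :=
    fun z => congrArg (fun A => A z) hfderiv
  exact ⟨hright.surjective, ContinuousLinearMap.closedComplemented_ker_of_rightInverse _ _ hright⟩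

end IsSmoothAtlas

theorem SmoothInto.isOpen_preimage (h : IsSmoothAtlas 𝒜) (hv : SmoothInto 𝒜 D v) {U : Set M}
    (hU : IsOpen[atlasTopology 𝒜] U) : IsOpen (D ∩ v ⁻¹' U) := by
  rw [← h.iUnion_source_inter_preimage_image U, Set.preimage_iUnion₂, Set.inter_iUnion₂]
  refine isOpen_biUnion fun c hc => ?_
  rw [Set.preimage_inter, ← Set.inter_assoc]
  exact (hv c hc).2.continuousOn.isOpen_inter_preimage (hv c hc).1 (h.isOpen_iff.1 hU c hc)

theorem SmoothInto.isOpen (h : IsSmoothAtlas 𝒜) (hv : SmoothInto 𝒜 D v) : IsOpen D := by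
  have hopen := hv.isOpen_preimage h (@isOpen_univ M (atlasTopology 𝒜))
  rwa [Set.preimage_univ, Set.inter_univ] at hopen

theorem SmoothInto.contDiffOn_comp (h : IsSmoothAtlas 𝒜) (hv : SmoothInto 𝒜 D v) {U : Set M}
    (hU : IsOpen[atlasTopology 𝒜] U) {F : Type*} [NormedAddCommGroup F] [NormedSpace ℝ F]
    {f : M → F} (hf : ∀ c ∈ 𝒜, ContDiffOn ℝ ∞ (c.pull f) (c.toFun '' (c.source ∩ U))) :
    ContDiffOn ℝ ∞ (fun y => f (v y)) (D ∩ v ⁻¹' U) := by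
  rintro y ⟨hy, hyU⟩
  obtain ⟨c, hc, hyc⟩ := h.cover (v y)
  have hcoord : ContDiffAt ℝ ∞ (fun y => c.toFun (v y)) y :=
    (hv c hc).2.contDiffAt ((hv c hc).1.mem_nhds ⟨hy, hyc⟩)
  have hpull : ContDiffAt ℝ ∞ (c.pull f) (c.toFun (v y)) :=
    (hf c hc).contDiffAt ((h.isOpen_iff.1 hU c hc).mem_nhds ⟨v y, ⟨hyc, hyU⟩, rfl⟩)
  refine ((hpull.comp y hcoord).congr_of_eventuallyEq ?_).contDiffWithinAt
  filter_upwards [(hv c hc).1.mem_nhds ⟨hy, hyc⟩] with z hz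
  exact (BanachChart.pull_toFun (h.injOn c hc) f hz.2).symm

end Manifold

/-! ### The restricted Grassmannian as a manifold -/

section Graph

variable {𝕜 H : Type*} [RCLike 𝕜] [NormedAddCommGroup H] [InnerProductSpace 𝕜 H]
  {K : Submodule 𝕜 H}

/-- The map `w ↦ w + A w`, whose range is the graph of an operator `A : K → Kᗮ`. -/
def graphMap (A : K →L[𝕜] Kᗮ) : K →L[𝕜] H := K.subtypeL + Kᗮ.subtypeL ∘L A

theorem range_graphMap_zero : (graphMap (0 : K →L[𝕜] Kᗮ)).range = K := by
  rw [graphMap, ContinuousLinearMap.comp_zero, add_zero]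
  exact K.range_subtype

variable [K.HasOrthogonalProjection]

theorem orthogonalProjectionOnto_comp_graphMap (A : K →L[𝕜] Kᗮ) :
    K.orthogonalProjectionOnto ∘L graphMap A = .id 𝕜 K := by
  ext x
  have hA : K.starProjection (A x : H) = 0 := K.starProjection_apply_eq_zero_iff.2 (A x).2
  simp [graphMap, hA]

theorem orthogonalProjectionOnto_orthogonal_comp_graphMap (A : K →L[𝕜] Kᗮ) :
    Kᗮ.orthogonalProjectionOnto ∘L graphMap A = A := by
  ext x
  simp [graphMap, Submodule.orthogonalProjectionOnto_orthogonal_apply_eq_zero x.2]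

theorem eq_graphMap {γ : K →L[𝕜] H} (hγ : K.orthogonalProjectionOnto ∘L γ = .id 𝕜 K) :
    γ = graphMap (Kᗮ.orthogonalProjectionOnto ∘L γ) := by
  ext x
  have hx : K.orthogonalProjectionOnto (γ x) = x := congrArg (fun B => B x) hγ
  have hsum := K.starProjection_add_starProjection_orthogonal (γ x)
  simp only [Submodule.starProjection_apply, hx] at hsum
  exact hsum.symm

theorem exists_equiv_of_eq_range_graphMap {L : Submodule 𝕜 H} {A : K →L[𝕜] Kᗮ}
    (hL : L = (graphMap A).range) :
    ∃ e : K ≃L[𝕜] L, L.subtypeL ∘L (e : K →L[𝕜] L) = graphMap A ∧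
      (e.symm : L →L[𝕜] K) = K.orthogonalProjectionOnto ∘L L.subtypeL := by
  subst hL
  let f : K →L[𝕜] (graphMap A).range := (graphMap A).codRestrict _ fun x => ⟨x, rfl⟩
  let p : (graphMap A).range →L[𝕜] K := K.orthogonalProjectionOnto ∘L Submodule.subtypeL _
  have hpf : ∀ x, K.orthogonalProjectionOnto (graphMap A x) = x := fun x =>
    congrArg (fun B => B x) (orthogonalProjectionOnto_comp_graphMap A)
  have hfp : f ∘L p = .id 𝕜 _ := by
    ext ⟨_, y, rfl⟩
    exact congrArg (graphMap A) (hpf y)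
  have hpf' : p ∘L f = .id 𝕜 _ := by
    ext x
    exact congrArg Subtype.val (hpf x)
  exact ⟨ContinuousLinearEquiv.equivOfInverse' f p hfp hpf', rfl, rfl⟩

theorem isClosed_range_graphMap (A : K →L[𝕜] Kᗮ) : IsClosed ((graphMap A).range : Set H) := by
  have hclosed : IsClosed {x : H | graphMap A (K.orthogonalProjectionOnto x) = x} :=
    isClosed_eq (by fun_prop) continuous_id
  convert hclosed
  ext x
  refine ⟨?_, fun hx => ⟨_, hx⟩⟩
  rintro ⟨y, rfl⟩
  exact congrArg (fun B => graphMap A (B y)) (orthogonalProjectionOnto_comp_graphMap A)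

theorem starProjection_sub_starProjection [CompleteSpace H] (L : Submodule 𝕜 H)
    [L.HasOrthogonalProjection] :
    L.starProjection - K.starProjection =
      Kᗮ.starProjection * L.starProjection - star (Lᗮ.starProjection * K.starProjection) := by
  simp only [Submodule.starProjection_orthogonal', star_mul, star_sub, star_one,
    isStarProjection_starProjection.isSelfAdjoint.star_eq]
  noncomm_ring

end Graph

section Grassmannian

variable {H : Type u} [NormedAddCommGroup H] [InnerProductSpace ℂ H]
  {Hp : Submodule ℂ H} [CompleteSpace Hp]

theorem plus_mem_restrictedSubspaces : Hp ∈ restrictedSubspaces Hp := by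
  refine ⟨(completeSpace_coe_iff_isComplete.1 inferInstance).isClosed, ?_, ?_⟩
  · have heq : Hp.orthogonalProjectionOnto ∘L Hp.subtypeL = .id ℂ Hp := by
      ext x
      simp
    rw [heq]
    exact isFredholm_equiv (.refl ℂ Hp)
  · have heq : Hpᗮ.orthogonalProjectionOnto ∘L Hp.subtypeL = 0 := by
      ext x
      simp [Submodule.orthogonalProjectionOnto_orthogonal_apply_eq_zero x.2]
    rw [heq]
    exact isHilbertSchmidt_zero

variable [CompleteSpace H]

namespace GrRes

theorem proj_eq (W : GrRes Hp) : W.proj = W.space.starProjection :=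
  (isStarProjection_iff_eq_starProjection_range.1 W.isStarProjection).2

theorem ext_space {V W : GrRes Hp} (h : V.space = W.space) : V = W := by
  refine GrRes.ext ?_
  rw [proj_eq, proj_eq]
  congr 1

theorem exists_space_eq {K : Submodule ℂ H} (hK : K ∈ restrictedSubspaces Hp) :
    ∃ V : GrRes Hp, V.space = K := by
  have : CompleteSpace K := completeSpace_coe_iff_isComplete.2 (IsClosed.isComplete hK.1)
  exact ⟨⟨K.starProjection, isStarProjection_starProjection,
    by rwa [Submodule.range_starProjection]⟩, Submodule.range_starProjection K⟩

theorem isFredholm_plus (W : GrRes Hp) :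
    (Hp.orthogonalProjectionOnto ∘L W.space.subtypeL).IsFredholm :=
  W.range_mem.2.1

theorem isHilbertSchmidt_minus (W : GrRes Hp) :
    IsHilbertSchmidt (Hpᗮ.orthogonalProjectionOnto ∘L W.space.subtypeL) :=
  W.range_mem.2.2

theorem isHilbertSchmidt_orthogonal_comp_subtypeL_plus (W : GrRes Hp) :
    IsHilbertSchmidt (W.spaceᗮ.starProjection ∘L Hp.subtypeL) := by
  refine isHilbertSchmidt_of_comp_isFredholm W.isFredholm_plus ?_
  have heq : (W.spaceᗮ.starProjection ∘L Hp.subtypeL) ∘L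
      (Hp.orthogonalProjectionOnto ∘L W.space.subtypeL) =
      -(W.spaceᗮ.starProjection ∘L Hpᗮ.subtypeL) ∘L
        (Hpᗮ.orthogonalProjectionOnto ∘L W.space.subtypeL) := by
    ext x
    have hx : W.spaceᗮ.starProjection (x : H) = 0 :=
      Submodule.starProjection_orthogonal_apply_eq_zero x.2
    rw [← Hp.starProjection_add_starProjection_orthogonal (x : H), map_add] at hx
    exact eq_neg_of_add_eq_zero_left hx
  exact heq ▸ (W.isHilbertSchmidt_minus.comp_left _).neg

theorem isHilbertSchmidt_proj_sub (W : GrRes Hp) :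
    IsHilbertSchmidt (W.proj - Hp.starProjection) := by
  have hminus : IsHilbertSchmidt (Hpᗮ.starProjection * W.space.starProjection) :=
    (W.isHilbertSchmidt_minus.comp_left Hpᗮ.subtypeL).comp_right W.space.orthogonalProjectionOnto
  have hplus : IsHilbertSchmidt (W.spaceᗮ.starProjection * Hp.starProjection) :=
    W.isHilbertSchmidt_orthogonal_comp_subtypeL_plus.comp_right Hp.orthogonalProjectionOnto
  rw [proj_eq, starProjection_sub_starProjection]
  exact hminus.sub hplus.adjoint

theorem isHilbertSchmidt_proj_sub_proj (V W : GrRes Hp) :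
    IsHilbertSchmidt (V.proj - W.proj) := by
  rw [← sub_sub_sub_cancel_right _ _ Hp.starProjection]
  exact V.isHilbertSchmidt_proj_sub.sub W.isHilbertSchmidt_proj_sub

theorem isHilbertSchmidt_orthogonal_comp_subtypeL (W V : GrRes Hp) :
    IsHilbertSchmidt (W.spaceᗮ.orthogonalProjectionOnto ∘L V.space.subtypeL) := by
  have heq : W.spaceᗮ.orthogonalProjectionOnto ∘L V.space.subtypeL =
      W.spaceᗮ.orthogonalProjectionOnto ∘L (V.proj - W.proj) ∘L V.space.subtypeL := by
    ext x
    have hx : V.space.starProjection (x : H) = x := Submodule.starProjection_eq_self_iff.2 x.2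
    have hWx : W.spaceᗮ.orthogonalProjectionOnto (W.space.starProjection (x : H)) = 0 :=
      Submodule.orthogonalProjectionOnto_orthogonal_apply_eq_zero
        (Submodule.starProjection_apply_mem _ _)
    simp [proj_eq, hx, hWx]
  rw [heq]
  exact ((V.isHilbertSchmidt_proj_sub_proj W).comp_right _).comp_left _

theorem toCLM_coord (W V : GrRes Hp) : HS.toCLM (W.coord V) =
    W.spaceᗮ.orthogonalProjectionOnto ∘L V.space.subtypeL ∘L (W.projRestrict V).inverse :=
  HS.toCLM_ofCLM ((W.isHilbertSchmidt_orthogonal_comp_subtypeL V).comp_right _)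

theorem space_eq_of_mem_source {W V : GrRes Hp} (hV : V ∈ W.chart.source) :
    V.space = (graphMap (HS.toCLM (W.coord V))).range := by
  obtain ⟨e, he⟩ := hV
  have hinverse : W.space.orthogonalProjectionOnto ∘L
      (V.space.subtypeL ∘L (W.projRestrict V).inverse) = .id ℂ _ := by
    change W.projRestrict V ∘L (W.projRestrict V).inverse = _
    rw [← he]
    ext x
    simp
  rw [toCLM_coord, ← eq_graphMap hinverse, ← he, ContinuousLinearMap.inverse_equiv]
  ext x
  constructor
  · intro hx
    exact ⟨e ⟨x, hx⟩, by simp⟩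
  · rintro ⟨y, rfl⟩
    exact (e.symm y).2

theorem mem_source_of_space_eq {W V : GrRes Hp} {A : W.space →L[ℂ] W.spaceᗮ}
    (h : V.space = (graphMap A).range) : V ∈ W.chart.source := by
  obtain ⟨e, -, he⟩ := exists_equiv_of_eq_range_graphMap h
  exact ⟨e.symm, he⟩

theorem coord_of_space_eq {W V : GrRes Hp} {A : HS W.space W.spaceᗮ}
    (h : V.space = (graphMap (HS.toCLM A)).range) : W.coord V = A := by
  obtain ⟨e, he, hsymm⟩ := exists_equiv_of_eq_range_graphMap h
  rw [coord, projRestrict, ← hsymm, ContinuousLinearMap.inverse_equiv,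
    ContinuousLinearEquiv.symm_symm, he, orthogonalProjectionOnto_orthogonal_comp_graphMap,
    HS.ofCLM_toCLM]

theorem injOn_coord (W : GrRes Hp) : Set.InjOn W.coord W.chart.source := fun V hV V' hV' h =>
  ext_space (by rw [space_eq_of_mem_source hV, space_eq_of_mem_source hV', h])

theorem range_graphMap_mem_restrictedSubspaces (W : GrRes Hp) (A : HS W.space W.spaceᗮ) :
    (graphMap (HS.toCLM A)).range ∈ restrictedSubspaces Hp := by
  obtain ⟨e, he, -⟩ := exists_equiv_of_eq_range_graphMap
    (rfl : (graphMap (HS.toCLM A)).range = (graphMap (HS.toCLM A)).range)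
  have hsub : (graphMap (HS.toCLM A)).range.subtypeL =
      graphMap (HS.toCLM A) ∘L (e.symm : _ →L[ℂ] W.space) := by
    ext x
    simpa using congrArg (fun B => B (e.symm x)) he
  have hclosed := isClosed_range_graphMap (HS.toCLM A)
  have : CompleteSpace (graphMap (HS.toCLM A)).range :=
    completeSpace_coe_iff_isComplete.2 hclosed.isComplete
  refine ⟨hclosed, ?_, ?_⟩
  · rw [hsub, ← ContinuousLinearMap.comp_assoc]
    refine isFredholm_comp ?_ (isFredholm_equiv e.symm)
    rw [graphMap, ContinuousLinearMap.comp_add]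
    exact isFredholm_add_isHilbertSchmidt W.isFredholm_plus
      ((A.isHilbertSchmidt.comp_left _).comp_left _)
  · rw [hsub, ← ContinuousLinearMap.comp_assoc]
    refine IsHilbertSchmidt.comp_right ?_ _
    rw [graphMap, ContinuousLinearMap.comp_add]
    exact W.isHilbertSchmidt_minus.add ((A.isHilbertSchmidt.comp_left _).comp_left _)

theorem image_coord (W : GrRes Hp) : W.coord '' W.chart.source = Set.univ := by
  refine Set.eq_univ_of_forall fun A => ?_
  obtain ⟨V, hV⟩ := exists_space_eq (W.range_graphMap_mem_restrictedSubspaces A)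
  exact ⟨V, mem_source_of_space_eq hV, coord_of_space_eq hV⟩

theorem self_mem_source (W : GrRes Hp) : W ∈ W.chart.source :=
  mem_source_of_space_eq range_graphMap_zero.symm

theorem coord_self (W : GrRes Hp) : W.coord W = 0 :=
  coord_of_space_eq (by rw [map_zero, range_graphMap_zero])

instance : Nonempty (GrRes Hp) := (exists_space_eq plus_mem_restrictedSubspaces).nonempty

theorem space_inv (W : GrRes Hp) (A : HS W.space W.spaceᗮ) :
    (W.chart.inv A).space = (graphMap (HS.toCLM A)).range := by
  have hA : A ∈ W.chart.toFun '' W.chart.source := W.image_coord ▸ Set.mem_univ A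
  have hcoord : W.coord (W.chart.inv A) = A := BanachChart.toFun_inv hA
  rw [space_eq_of_mem_source (BanachChart.inv_mem hA), hcoord]

theorem inv_mem_source_iff (W W' : GrRes Hp) (A : HS W.space W.spaceᗮ) :
    W.chart.inv A ∈ W'.chart.source ↔
      (W'.space.orthogonalProjectionOnto ∘L graphMap (HS.toCLM A)).IsInvertible := by
  obtain ⟨e, he, -⟩ := exists_equiv_of_eq_range_graphMap (W.space_inv A)
  rw [← he, ← ContinuousLinearMap.comp_assoc]
  exact ContinuousLinearMap.isInvertible_comp_equiv.symm

theorem coord_eq_of_space_eq {W V : GrRes Hp} (W' : GrRes Hp) {A : HS W.space W.spaceᗮ}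
    (h : V.space = (graphMap (HS.toCLM A)).range) :
    W'.coord V = HS.compRight _ _ _
      (HS.ofCLM (W'.spaceᗮ.orthogonalProjectionOnto ∘L W.space.subtypeL) +
        HS.compLeft _ _ _ (W'.spaceᗮ.orthogonalProjectionOnto ∘L W.spaceᗮ.subtypeL) A)
      (W'.space.orthogonalProjectionOnto ∘L graphMap (HS.toCLM A)).inverse := by
  obtain ⟨e, he, -⟩ := exists_equiv_of_eq_range_graphMap h
  have hinverse : (W'.projRestrict V).inverse = (e : W.space →L[ℂ] _) ∘L
      (W'.space.orthogonalProjectionOnto ∘L graphMap (HS.toCLM A)).inverse := by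
    rw [← he, ← ContinuousLinearMap.comp_assoc, ContinuousLinearMap.inverse_comp_equiv]
    ext x
    simp [projRestrict]
  apply HS.toCLM_injective
  rw [toCLM_coord, HS.toCLM_compRight, map_add,
    HS.toCLM_ofCLM (W'.isHilbertSchmidt_orthogonal_comp_subtypeL W), HS.toCLM_compLeft, hinverse,
    ContinuousLinearMap.comp_assoc, ← ContinuousLinearMap.comp_add,
    ← ContinuousLinearMap.comp_assoc V.space.subtypeL, he]
  rfl

theorem smoothInto_inv (W : GrRes Hp) : SmoothInto (grAtlas Hp) Set.univ W.chart.inv := by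
  rintro _ ⟨W', rfl⟩
  let f : HS W.space W.spaceᗮ → (W.space →L[ℂ] W'.space) := fun A =>
    W'.space.orthogonalProjectionOnto ∘L graphMap (HS.toCLM A)
  have hf : ContDiff ℝ ∞ f := contDiff_iff_contDiffAt.2 fun A =>
    contDiffAt_comp contDiffAt_const
      (contDiffAt_const.add (contDiffAt_comp contDiffAt_const HS.contDiff_toCLM.contDiffAt))
  have domain_eq : Set.univ ∩ W.chart.inv ⁻¹' W'.chart.source = f ⁻¹' {T | T.IsInvertible} := by
    ext A
    rw [Set.univ_inter]
    exact W.inv_mem_source_iff W' A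
  rw [domain_eq]
  refine ⟨ContinuousLinearEquiv.isOpen.preimage hf.continuous, fun A hA => ?_⟩
  have hinverse : ContDiffAt ℝ ∞ (fun A => (f A).inverse) A :=
    (ContinuousLinearMap.IsInvertible.contDiffAt_map_inverse hA |>.restrict_scalars ℝ).comp A
      hf.contDiffAt
  exact ((HS.contDiffAt_compRight (contDiffAt_const.add
    (HS.contDiffAt_compLeft contDiffAt_const contDiffAt_id)) hinverse).congr_of_eventuallyEq
      (Filter.Eventually.of_forall fun A =>
        coord_eq_of_space_eq W' (W.space_inv A))).contDiffWithinAt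

end GrRes

theorem isSmoothAtlas_grAtlas : IsSmoothAtlas (grAtlas Hp) where
  injOn := by
    rintro _ ⟨W, rfl⟩
    exact W.injOn_coord
  cover W := ⟨W.chart, ⟨W, rfl⟩, W.self_mem_source⟩
  smoothInto_inv := by
    rintro _ ⟨W, rfl⟩
    have himage : W.chart.toFun '' W.chart.source = Set.univ := W.image_coord
    rw [himage]
    exact W.smoothInto_inv

end Grassmannian

/-! ### The Cayley transform and charts of the unitary group -/

section Cayley

variable {R : Type*} [Ring R]

/-- The Cayley transform `(1 + x) / (1 - x)`, meaningful when `1 - x` is invertible. -/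
def cayley (x : R) : R := (1 + x) * Ring.inverse (1 - x)

/-- The inverse Cayley transform `(m - 1) / (m + 1)`, written so that it involves `m` only once;
it is meaningful when `m + 1` is invertible. -/
def invCayley (m : R) : R := 1 - 2 * Ring.inverse (m + 1)

theorem cayley_add_one {x : R} (hx : IsUnit (1 - x)) :
    cayley x + 1 = 2 * Ring.inverse (1 - x) := by
  calc cayley x + 1 = (1 + x) * Ring.inverse (1 - x) + (1 - x) * Ring.inverse (1 - x) := by
        rw [Ring.mul_inverse_cancel _ hx, cayley]
    _ = 2 * Ring.inverse (1 - x) := by rw [← add_mul, add_add_sub_cancel, one_add_one_eq_two]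

theorem cayley_eq_one_add {x : R} (hx : IsUnit (1 - x)) :
    cayley x = 1 + 2 * (x * Ring.inverse (1 - x)) := by
  calc cayley x = (1 - x) * Ring.inverse (1 - x) + 2 * (x * Ring.inverse (1 - x)) := by
        rw [cayley]
        noncomm_ring
    _ = 1 + 2 * (x * Ring.inverse (1 - x)) := by rw [Ring.mul_inverse_cancel _ hx]

theorem isUnit_cayley_add_one (htwo : IsUnit (2 : R)) {x : R} (hx : IsUnit (1 - x)) :
    IsUnit (cayley x + 1) := by
  rw [cayley_add_one hx]
  exact htwo.mul hx.ringInverse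

theorem isUnit_one_sub_invCayley (htwo : IsUnit (2 : R)) {m : R} (hm : IsUnit (m + 1)) :
    IsUnit (1 - invCayley m) := by
  rw [invCayley, sub_sub_cancel]
  exact htwo.mul hm.ringInverse

theorem cayley_invCayley (htwo : IsUnit (2 : R)) {m : R} (hm : IsUnit (m + 1)) :
    cayley (invCayley m) = m := by
  have hunit := isUnit_one_sub_invCayley htwo hm
  have hinv : (m + 1) * Ring.inverse (m + 1) = 1 := Ring.mul_inverse_cancel _ hm
  refine hunit.mul_right_cancel ?_
  rw [cayley, mul_assoc, Ring.inverse_mul_cancel _ hunit, mul_one, invCayley]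
  calc 1 + (1 - 2 * Ring.inverse (m + 1))
      = 2 * ((m + 1) * Ring.inverse (m + 1)) - 2 * Ring.inverse (m + 1) := by
        rw [hinv]
        noncomm_ring
    _ = m * (1 - (1 - 2 * Ring.inverse (m + 1))) := by noncomm_ring

theorem invCayley_cayley (htwo : IsUnit (2 : R)) {x : R} (hx : IsUnit (1 - x)) :
    invCayley (cayley x) = x := by
  have hm := isUnit_cayley_add_one htwo hx
  have hmul : (1 - x) * (cayley x + 1) = 2 := by
    calc (1 - x) * (cayley x + 1) = 2 * ((1 - x) * Ring.inverse (1 - x)) := by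
          rw [cayley_add_one hx]
          noncomm_ring
      _ = 2 := by rw [Ring.mul_inverse_cancel _ hx, mul_one]
  rw [invCayley, ← hmul, Ring.mul_inverse_cancel_right _ _ hm, sub_sub_cancel]

theorem cayley_mem_unitary [StarRing R] {x : R} (hx : star x = -x) (hunit : IsUnit (1 - x)) :
    cayley x ∈ unitary R := by
  have hstar_sub : star (1 - x) = 1 + x := by rw [star_sub, star_one, hx, sub_neg_eq_add]
  have hstar_add : star (1 + x) = 1 - x := by rw [star_add, star_one, hx, ← sub_eq_add_neg]
  have hunit_add : IsUnit (1 + x) := hstar_sub ▸ hunit.star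
  have hcomm : Commute (1 - x) (1 + x) := by
    rw [commute_iff_eq]
    noncomm_ring
  have hstar : star (cayley x) = Ring.inverse (1 + x) * (1 - x) := by
    rw [cayley, star_mul, ← Ring.inverse_star, hstar_sub, hstar_add]
  constructor
  · rw [hstar, cayley, mul_assoc, ← mul_assoc (1 - x), hcomm.eq, mul_assoc,
      Ring.mul_inverse_cancel _ hunit, mul_one, Ring.inverse_mul_cancel _ hunit_add]
  · rw [hstar, cayley, mul_assoc, ← mul_assoc (Ring.inverse (1 - x)),
      Commute.ringInverse_ringInverse hcomm, mul_assoc, Ring.inverse_mul_cancel _ hunit, mul_one,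
      Ring.mul_inverse_cancel _ hunit_add]

theorem star_invCayley [StarRing R] {m : R} (hm : m ∈ unitary R) (hunit : IsUnit (m + 1)) :
    star (invCayley m) = -invCayley m := by
  have hinv : (m + 1) * Ring.inverse (m + 1) = 1 := Ring.mul_inverse_cancel _ hunit
  have hstar_inv : star (Ring.inverse (m + 1)) * star (m + 1) = 1 := by
    rw [← star_mul, hinv, star_one]
  have hsum : Ring.inverse (m + 1) + star (Ring.inverse (m + 1)) = 1 := by
    refine hunit.mul_left_cancel (hunit.star.mul_right_cancel ?_)
    rw [mul_add, hinv, add_mul, mul_assoc, hstar_inv, mul_one, one_mul, star_add, star_one,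
      mul_add, add_mul, mul_one, hm.2]
    noncomm_ring
  rw [invCayley, star_sub, star_one, star_mul, eq_sub_of_add_eq' hsum, star_ofNat]
  noncomm_ring

theorem isUnit_two (R : Type*) [Ring R] [Algebra ℂ R] : IsUnit (2 : R) :=
  map_ofNat (algebraMap ℂ R) 2 ▸ (IsUnit.mk0 (2 : ℂ) two_ne_zero).map (algebraMap ℂ R)

end Cayley

section UnitaryGroup

variable {K : Type u} [NormedAddCommGroup K] [InnerProductSpace ℂ K] [CompleteSpace K]

namespace SkewOp

variable (K) in
/-- The inclusion of the skew-adjoint operators into the bounded operators. -/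
def incl : SkewOp K →L[ℝ] (K →L[ℂ] K) := (skewAdjoint.submodule ℝ (K →L[ℂ] K)).subtypeL

theorem star_incl (X : SkewOp K) : star (incl K X) = -incl K X := X.2

theorem incl_injective : Function.Injective (incl K) := Subtype.val_injective

variable (K) in
/-- The skew-adjoint part `(T - T*) / 2` of an operator. -/
def part : (K →L[ℂ] K) →L[ℝ] SkewOp K :=
  skewAdjointPartL ℝ (K →L[ℂ] K)

theorem incl_part {T : K →L[ℂ] K} (hT : star T = -T) : incl K (part K T) = T := by
  change (⅟2 : ℝ) • (T - star T) = T
  rw [hT, sub_neg_eq_add, ← two_smul ℝ T, invOf_smul_smul]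

end SkewOp

namespace UnitaryChart

theorem source_subset (a : UnitaryChart K) : a.source ⊆ unitary (K →L[ℂ] K) := by
  obtain ⟨O, -, hO⟩ := a.isOpen_source
  rw [hO]
  exact Set.inter_subset_right

theorem symm_toFun (a : UnitaryChart K) {k : K →L[ℂ] K} (hk : k ∈ a.source) :
    a.symm (a.toFun k) = k :=
  a.injOn.leftInvOn_invFunOn hk

theorem contDiffAt_comp {Y : Type*} [NormedAddCommGroup Y] [NormedSpace ℝ Y] (a : UnitaryChart K)
    {r : Y → K →L[ℂ] K} {y : Y} (hr : ContDiffAt ℝ ∞ r y) (hra : ∀ᶠ z in 𝓝 y, r z ∈ a.source) :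
    ContDiffAt ℝ ∞ (fun y => a.toFun (r y)) y := by
  obtain ⟨F, hF, hFa⟩ := a.smooth (r y) hra.self_of_nhds
  have htendsto : Filter.Tendsto r (𝓝 y) (𝓝[a.source] r y) :=
    tendsto_nhdsWithin_iff.2 ⟨hr.continuousAt, hra⟩
  exact (hF.comp y hr).congr_of_eventuallyEq
    ((htendsto.eventually hFa).mono fun _ hz => hz.symm)

/-- The domain of the Cayley chart based at the unitary operator `k`. -/
def cayleySource (k : K →L[ℂ] K) : Set (K →L[ℂ] K) :=
  {l | IsUnit (star k * l + 1)} ∩ unitary (K →L[ℂ] K)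

/-- The Cayley chart based at `k`, sending `k` to `0`. On `cayleySource k` the inverse Cayley
transform is already skew-adjoint; taking the skew-adjoint part makes this visible to the type. -/
def cayleyToFun (k l : K →L[ℂ] K) : SkewOp K := SkewOp.part K (invCayley (star k * l))

/-- The inverse of the Cayley chart based at `k`. -/
def cayleySymm (k : K →L[ℂ] K) (X : SkewOp K) : K →L[ℂ] K := k * cayley (SkewOp.incl K X)

variable {k l : K →L[ℂ] K} {X : SkewOp K}

theorem incl_cayleyToFun (hk : k ∈ unitary (K →L[ℂ] K)) (hl : l ∈ cayleySource k) :
    SkewOp.incl K (cayleyToFun k l) = invCayley (star k * l) :=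
  SkewOp.incl_part (star_invCayley (mul_mem (Unitary.star_mem hk) hl.2) hl.1)

theorem cayleySymm_cayleyToFun (hk : k ∈ unitary (K →L[ℂ] K)) (hl : l ∈ cayleySource k) :
    cayleySymm k (cayleyToFun k l) = l := by
  rw [cayleySymm, incl_cayleyToFun hk hl, cayley_invCayley (isUnit_two _) hl.1, ← mul_assoc, hk.2,
    one_mul]

theorem star_mul_cayleySymm (hk : k ∈ unitary (K →L[ℂ] K)) :
    star k * cayleySymm k X = cayley (SkewOp.incl K X) := by
  rw [cayleySymm, ← mul_assoc, hk.1, one_mul]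

theorem cayleySymm_mem_cayleySource (hk : k ∈ unitary (K →L[ℂ] K))
    (hX : IsUnit (1 - SkewOp.incl K X)) : cayleySymm k X ∈ cayleySource k := by
  refine ⟨?_, mul_mem hk (cayley_mem_unitary X.star_incl hX)⟩
  rw [Set.mem_ofPred_eq, star_mul_cayleySymm hk]
  exact isUnit_cayley_add_one (isUnit_two _) hX

theorem cayleyToFun_cayleySymm (hk : k ∈ unitary (K →L[ℂ] K))
    (hX : IsUnit (1 - SkewOp.incl K X)) : cayleyToFun k (cayleySymm k X) = X := by
  apply SkewOp.incl_injective
  rw [incl_cayleyToFun hk (cayleySymm_mem_cayleySource hk hX), star_mul_cayleySymm hk,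
    invCayley_cayley (isUnit_two _) hX]

theorem image_cayleySource (hk : k ∈ unitary (K →L[ℂ] K)) :
    cayleyToFun k '' cayleySource k = {X | IsUnit (1 - SkewOp.incl K X)} := by
  ext X
  constructor
  · rintro ⟨l, hl, rfl⟩
    rw [Set.mem_ofPred_eq, incl_cayleyToFun hk hl]
    exact isUnit_one_sub_invCayley (isUnit_two _) hl.1
  · exact fun hX =>
      ⟨cayleySymm k X, cayleySymm_mem_cayleySource hk hX, cayleyToFun_cayleySymm hk hX⟩

theorem injOn_cayleyToFun (hk : k ∈ unitary (K →L[ℂ] K)) :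
    Set.InjOn (cayleyToFun k) (cayleySource k) :=
  Set.LeftInvOn.injOn (f₁' := cayleySymm k) fun _ hl => cayleySymm_cayleyToFun hk hl

theorem invFunOn_cayleyToFun (hk : k ∈ unitary (K →L[ℂ] K)) (hX : IsUnit (1 - SkewOp.incl K X)) :
    Function.invFunOn (cayleyToFun k) (cayleySource k) X = cayleySymm k X := by
  have himage : X ∈ cayleyToFun k '' cayleySource k := (image_cayleySource hk).symm ▸ hX
  exact injOn_cayleyToFun hk (Function.invFunOn_mem himage) (cayleySymm_mem_cayleySource hk hX)
    ((Function.invFunOn_eq himage).trans (cayleyToFun_cayleySymm hk hX).symm)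

theorem contDiffAt_cayleyToFun (hl : l ∈ cayleySource k) : ContDiffAt ℝ ∞ (cayleyToFun k) l :=
  (SkewOp.part K).contDiff.contDiffAt.comp l (contDiffAt_const.sub (contDiffAt_const.mul
    (contDiffAt_ringInverse_comp
      ((contDiffAt_const.mul contDiffAt_id).add contDiffAt_const) hl.1)))

theorem contDiffAt_cayleySymm (k : K →L[ℂ] K) (hX : IsUnit (1 - SkewOp.incl K X)) :
    ContDiffAt ℝ ∞ (cayleySymm k) X := by
  have hincl : ContDiffAt ℝ ∞ (SkewOp.incl K) X := (SkewOp.incl K).contDiff.contDiffAt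
  exact contDiffAt_const.mul ((contDiffAt_const.add hincl).mul
    (contDiffAt_ringInverse_comp (contDiffAt_const.sub hincl) hX))

/-- The Cayley chart of the unitary group based at `k`. -/
def cayleyChart (hk : k ∈ unitary (K →L[ℂ] K)) : UnitaryChart K where
  source := cayleySource k
  toFun := cayleyToFun k
  isOpen_source := ⟨_, Units.isOpen.preimage (by fun_prop), rfl⟩
  injOn := injOn_cayleyToFun hk
  isOpen_image := by
    rw [image_cayleySource hk]
    exact Units.isOpen.preimage (by fun_prop)
  smooth l hl :=
    ⟨cayleyToFun k, contDiffAt_cayleyToFun hl, Filter.Eventually.of_forall fun _ => rfl⟩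
  smooth_symm := by
    rw [image_cayleySource hk]
    exact fun X hX => (contDiffAt_cayleySymm k hX).contDiffWithinAt.congr_of_mem
      (fun Z hZ => invFunOn_cayleyToFun hk hZ) hX

theorem exists_mem_source (hk : k ∈ unitary (K →L[ℂ] K)) : ∃ a : UnitaryChart K, k ∈ a.source := by
  refine ⟨cayleyChart hk, ?_, hk⟩
  rw [Set.mem_ofPred_eq, hk.1, one_add_one_eq_two]
  exact isUnit_two _

end UnitaryChart

end UnitaryGroup

/-! ### Local cross sections -/

section Complement

variable {𝕜 H : Type*} [RCLike 𝕜] [NormedAddCommGroup H] [InnerProductSpace 𝕜 H]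
  {K L : Submodule 𝕜 H} [K.HasOrthogonalProjection] [L.HasOrthogonalProjection]

theorem exists_linearIsometryEquiv_map_eq (U : K ≃ₗᵢ[𝕜] L) (V : Kᗮ ≃ₗᵢ[𝕜] Lᗮ) :
    ∃ g : H ≃ₗᵢ[𝕜] H, K.map g.toLinearEquiv.toLinearMap = L := by
  let g : H ≃ₗᵢ[𝕜] H := K.orthogonalDecomposition.trans
    ((U.withLpProdCongr 2 V).trans L.orthogonalDecomposition.symm)
  have hg : ∀ x : K, g x = U x := fun x => by
    simp [g, Submodule.orthogonalProjectionOnto_orthogonal_apply_eq_zero x.2]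
  refine ⟨g, le_antisymm ?_ fun y hy => ?_⟩
  · rintro _ ⟨x, hx, rfl⟩
    exact (hg ⟨x, hx⟩).symm ▸ (U ⟨x, hx⟩).2
  · exact ⟨U.symm ⟨y, hy⟩, Subtype.mem _, (hg _).trans (by simp)⟩

theorem starProjection_mul_of_map_eq [CompleteSpace H] {u : H →L[𝕜] H}
    (hu : u ∈ unitary (H →L[𝕜] H)) (hKL : K.map u.toLinearMap = L) :
    L.starProjection * u = u * K.starProjection := by
  subst hKL
  ext x
  let f : H ≃ₗᵢ[𝕜] H := Unitary.linearIsometryEquiv ⟨u, hu⟩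
  have hf := Submodule.starProjection_map_apply f K (f x)
  rw [f.symm_apply_apply] at hf
  exact hf

end Complement

section Transitivity

variable {H : Type u} [NormedAddCommGroup H] [InnerProductSpace ℂ H] [CompleteSpace H]

theorem isHilbertSchmidt_starProjection_iff {K : Submodule ℂ H} [CompleteSpace K] :
    IsHilbertSchmidt K.starProjection ↔ FiniteDimensional ℂ K := by
  constructor
  · intro hK
    refine finiteDimensional_of_isHilbertSchmidt_id ?_
    convert (hK.comp_right K.subtypeL).comp_left K.orthogonalProjectionOnto
    ext x
    simp
  · intro hK
    have : FiniteDimensional ℂ K.starProjection.range := by rwa [Submodule.range_starProjection]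
    exact isHilbertSchmidt_of_finiteRange

namespace GrRes

variable {Hp : Submodule ℂ H} [CompleteSpace Hp]

theorem finiteDimensional_space_iff (W : GrRes Hp) :
    FiniteDimensional ℂ W.space ↔ FiniteDimensional ℂ Hp := by
  rw [← isHilbertSchmidt_starProjection_iff, ← isHilbertSchmidt_starProjection_iff, ← proj_eq]
  constructor
  · intro hW
    simpa only [sub_sub_cancel] using hW.sub W.isHilbertSchmidt_proj_sub
  · intro hp
    simpa only [sub_add_cancel] using W.isHilbertSchmidt_proj_sub.add hp

theorem finiteDimensional_orthogonal_iff (W : GrRes Hp) :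
    FiniteDimensional ℂ W.spaceᗮ ↔ FiniteDimensional ℂ Hpᗮ := by
  have hsub : Hpᗮ.starProjection = W.spaceᗮ.starProjection + (W.proj - Hp.starProjection) := by
    rw [proj_eq, Submodule.starProjection_orthogonal', Submodule.starProjection_orthogonal']
    abel
  rw [← isHilbertSchmidt_starProjection_iff, ← isHilbertSchmidt_starProjection_iff, hsub]
  constructor
  · intro hW
    exact hW.add W.isHilbertSchmidt_proj_sub
  · intro hp
    simpa only [add_sub_cancel_right] using hp.sub W.isHilbertSchmidt_proj_sub

theorem exists_mem_unitaryRes [TopologicalSpace.SeparableSpace H]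
    (hplus : ¬ FiniteDimensional ℂ Hp) (hminus : ¬ FiniteDimensional ℂ Hpᗮ) (W : GrRes Hp) :
    ∃ g ∈ unitaryRes Hp, Hp.map g.toLinearMap = W.space := by
  have : SecondCountableTopology H := UniformSpace.secondCountable_of_separable H
  obtain ⟨U⟩ := nonempty_linearIsometryEquiv hplus (W.finiteDimensional_space_iff.not.2 hplus)
  obtain ⟨V⟩ := nonempty_linearIsometryEquiv hminus
    (W.finiteDimensional_orthogonal_iff.not.2 hminus)
  obtain ⟨g, hg⟩ := exists_linearIsometryEquiv_map_eq U V
  let u : unitary (H →L[ℂ] H) := Unitary.linearIsometryEquiv.symm g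
  have hu : Hp.map (u : H →L[ℂ] H).toLinearMap = W.space := hg
  refine ⟨u, ⟨u.2, ?_⟩, hu⟩
  rw [commPlus, ← starProjection_mul_of_map_eq u.2 hu, ← proj_eq, ← sub_mul]
  exact W.isHilbertSchmidt_proj_sub.comp_right _

end GrRes

end Transitivity

section Rotation

variable {H : Type u} [NormedAddCommGroup H] [InnerProductSpace ℂ H] [CompleteSpace H]
  {K : Submodule ℂ H} [CompleteSpace K] {A : HS K Kᗮ}

/-- The skew-adjoint operator `A - A*` on `H`, for `A : K → Kᗮ`. -/
def skewLift (A : HS K Kᗮ) : HS H H :=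
  HS.compLeft _ _ _ Kᗮ.subtypeL (HS.compRight _ _ _ A K.orthogonalProjectionOnto) -
  HS.compLeft _ _ _ K.subtypeL
    (HS.compRight _ _ _ (HS.adjointL _ _ A) Kᗮ.orthogonalProjectionOnto)

/-- The Hilbert–Schmidt part `2x / (1 - x)`, `x = A - A*`, of the unitary operator `rotation A`. -/
def rotationHS (A : HS K Kᗮ) : HS H H :=
  (2 : ℝ) • HS.compRight _ _ _ (skewLift A) (Ring.inverse (1 - HS.toCLM (skewLift A)))

/-- The Cayley transform of `A - A*`. If `A` is the tangent of an angle operator `θ`, this is the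
rotation by `2θ` in the planes spanned by `w ∈ K` and `A w`. -/
def rotation (A : HS K Kᗮ) : H →L[ℂ] H := 1 + HS.toCLM (rotationHS A)

/-- The operator `A*A` on `K`. -/
def adjointSq (A : HS K Kᗮ) : K →L[ℂ] K := HS.toCLM (HS.adjointL _ _ A) ∘L HS.toCLM A

/-- The operator `2A (1 - A*A)⁻¹`: the double angle formula for the tangent. Its graph is the image
of `K` under `rotation A`. -/
def doubleAngle (A : HS K Kᗮ) : HS K Kᗮ :=
  (2 : ℝ) • HS.compRight _ _ _ A (Ring.inverse (1 - adjointSq A))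

variable (K) in
/-- The operators `A : K → Kᗮ` for which `rotation A` and `doubleAngle A` are given by honest
inverses and are related to each other. -/
def rotationDomain : Set (HS K Kᗮ) :=
  {A | IsUnit (1 - HS.toCLM (skewLift A)) ∧ IsUnit (1 - adjointSq A) ∧ IsUnit (1 + adjointSq A)}

theorem skewLift_apply (A : HS K Kᗮ) (x : H) : HS.toCLM (skewLift A) x =
    (HS.toCLM A (K.orthogonalProjectionOnto x) : H) -
      (HS.toCLM A).adjoint (Kᗮ.orthogonalProjectionOnto x) := rfl

theorem skewLift_apply_coe (A : HS K Kᗮ) (w : K) :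
    HS.toCLM (skewLift A) w = HS.toCLM A w := by
  rw [skewLift_apply, Submodule.orthogonalProjectionOnto_mem_subspace_eq_self,
    Submodule.orthogonalProjectionOnto_orthogonal_apply_eq_zero w.2, map_zero,
    Submodule.coe_zero, sub_zero]

theorem skewLift_apply_toCLM (A : HS K Kᗮ) (w : K) :
    HS.toCLM (skewLift A) (HS.toCLM A w) = -(adjointSq A w : H) := by
  rw [skewLift_apply, Submodule.orthogonalProjectionOnto_mem_subspace_eq_self,
    Submodule.orthogonalProjectionOnto_apply_of_mem_orthogonal (HS.toCLM A w).2, map_zero,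
    Submodule.coe_zero, zero_sub]
  rfl

theorem star_skewLift (A : HS K Kᗮ) :
    star (HS.toCLM (skewLift A)) = -HS.toCLM (skewLift A) := by
  rw [skewLift, map_sub, star_sub, ContinuousLinearMap.star_eq_adjoint,
    ContinuousLinearMap.star_eq_adjoint]
  simp only [HS.toCLM_compLeft, HS.toCLM_compRight, HS.toCLM_adjointL,
    ContinuousLinearMap.adjoint_comp, Submodule.adjoint_subtypeL,
    Submodule.adjoint_orthogonalProjectionOnto, ContinuousLinearMap.adjoint_adjoint]
  rw [neg_sub]
  rfl

theorem skewLift_zero : skewLift (0 : HS K Kᗮ) = 0 := by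
  simp only [skewLift, map_zero, zero_apply, sub_self]

theorem adjointSq_zero : adjointSq (0 : HS K Kᗮ) = 0 := by
  rw [adjointSq, map_zero, map_zero, map_zero, ContinuousLinearMap.comp_zero]

theorem doubleAngle_zero : doubleAngle (0 : HS K Kᗮ) = 0 := by
  simp only [doubleAngle, map_zero, zero_apply, smul_zero]

theorem zero_mem_rotationDomain : 0 ∈ rotationDomain K := by
  simp only [rotationDomain, Set.mem_ofPred_eq, skewLift_zero, adjointSq_zero, map_zero, sub_zero,
    add_zero, isUnit_one, and_self]

theorem rotation_eq_cayley (hA : A ∈ rotationDomain K) :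
    rotation A = cayley (HS.toCLM (skewLift A)) := by
  rw [cayley_eq_one_add hA.1, two_mul, ← two_smul ℝ]
  rfl

theorem rotation_mem_unitary (hA : A ∈ rotationDomain K) : rotation A ∈ unitary (H →L[ℂ] H) := by
  rw [rotation_eq_cayley hA]
  exact cayley_mem_unitary (star_skewLift A) hA.1

theorem doubleAngle_apply (hA : A ∈ rotationDomain K) (w : K) :
    HS.toCLM (doubleAngle A) ((1 - adjointSq A) w) = (2 : ℝ) • HS.toCLM A w := by
  change (2 : ℝ) • HS.toCLM A ((Ring.inverse (1 - adjointSq A) * (1 - adjointSq A)) w) = _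
  rw [Ring.inverse_mul_cancel _ hA.2.1, one_apply_eq_self]

theorem rotation_apply (hA : A ∈ rotationDomain K) (w : K) :
    rotation A ((1 + adjointSq A) w : K) =
      graphMap (HS.toCLM (doubleAngle A)) ((1 - adjointSq A) w) := by
  set x := HS.toCLM (skewLift A) with hx
  have hsub : (((1 + adjointSq A) w : K) : H) = (1 - x) ((w : H) + HS.toCLM A w) := by
    simp only [add_apply, sub_apply, one_apply_eq_self, map_add, hx, skewLift_apply_coe,
      skewLift_apply_toCLM, Submodule.coe_add]
    abel
  have hadd : (1 + x) ((w : H) + HS.toCLM A w) =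
      ((1 - adjointSq A) w : K) + (2 : ℝ) • (HS.toCLM A w : H) := by
    simp only [add_apply, sub_apply, one_apply_eq_self, map_add, hx, skewLift_apply_coe,
      skewLift_apply_toCLM, two_smul, Submodule.coe_sub]
    abel
  calc rotation A ((1 + adjointSq A) w : K)
      = (1 + x) ((Ring.inverse (1 - x) * (1 - x)) ((w : H) + HS.toCLM A w)) := by
        rw [rotation_eq_cayley hA, hsub]
        rfl
    _ = ((1 - adjointSq A) w : K) + (2 : ℝ) • (HS.toCLM A w : H) := by
        rw [Ring.inverse_mul_cancel _ hA.1, one_apply_eq_self, hadd]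
    _ = graphMap (HS.toCLM (doubleAngle A)) ((1 - adjointSq A) w) :=
        congrArg (fun y : Kᗮ => (((1 - adjointSq A) w : K) : H) + y) (doubleAngle_apply hA w).symm

theorem map_rotation (hA : A ∈ rotationDomain K) :
    K.map (rotation A).toLinearMap = (graphMap (HS.toCLM (doubleAngle A))).range := by
  have surjective_of_isUnit : ∀ {T : K →L[ℂ] K}, IsUnit T → Function.Surjective T :=
    fun {T} hT y => ⟨Ring.inverse T y, congrArg (fun B => B y) (Ring.mul_inverse_cancel _ hT)⟩
  ext y
  constructor
  · rintro ⟨w, hw, rfl⟩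
    obtain ⟨z, hz⟩ := surjective_of_isUnit hA.2.2 ⟨w, hw⟩
    have hrot := rotation_apply hA z
    rw [hz] at hrot
    exact ⟨_, hrot.symm⟩
  · rintro ⟨w, rfl⟩
    obtain ⟨z, rfl⟩ := surjective_of_isUnit hA.2.1 w
    exact ⟨_, Subtype.mem _, rotation_apply hA z⟩

section Smooth

variable {n : WithTop ℕ∞}

theorem contDiff_skewLift : ContDiff ℝ n (skewLift (K := K)) :=
  contDiff_iff_contDiffAt.2 fun _ =>
    (HS.contDiffAt_compLeft contDiffAt_const
      (HS.contDiffAt_compRight contDiffAt_id contDiffAt_const)).sub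
    (HS.contDiffAt_compLeft contDiffAt_const
      (HS.contDiffAt_compRight (HS.contDiffAt_adjointL contDiffAt_id) contDiffAt_const))

theorem contDiff_toCLM_skewLift : ContDiff ℝ n fun A : HS K Kᗮ => HS.toCLM (skewLift A) :=
  HS.contDiff_toCLM.comp contDiff_skewLift

theorem contDiff_adjointSq : ContDiff ℝ n (adjointSq (K := K)) :=
  contDiff_iff_contDiffAt.2 fun A =>
    contDiffAt_comp (HS.contDiff_toCLM.contDiffAt.comp A (HS.contDiffAt_adjointL contDiffAt_id))
      HS.contDiff_toCLM.contDiffAt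

theorem contDiffAt_rotationHS (hA : A ∈ rotationDomain K) : ContDiffAt ℝ n rotationHS A :=
  contDiffAt_const.smul (HS.contDiffAt_compRight contDiff_skewLift.contDiffAt
    (contDiffAt_ringInverse_comp
      (contDiffAt_const.sub contDiff_toCLM_skewLift.contDiffAt) hA.1))

theorem contDiffAt_doubleAngle (hA : A ∈ rotationDomain K) : ContDiffAt ℝ n doubleAngle A :=
  contDiffAt_const.smul
    (HS.contDiffAt_compRight contDiffAt_id
      (contDiffAt_ringInverse_comp (contDiffAt_const.sub contDiff_adjointSq.contDiffAt) hA.2.1))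

end Smooth

theorem isOpen_rotationDomain : IsOpen (rotationDomain K) := by
  have hskew : Continuous fun A : HS K Kᗮ => 1 - HS.toCLM (skewLift A) :=
    (contDiff_const.sub (contDiff_toCLM_skewLift (n := 0))).continuous
  have hsq : ContDiff ℝ 0 (adjointSq (K := K)) := contDiff_adjointSq
  have hsub : Continuous fun A : HS K Kᗮ => 1 - adjointSq A := (contDiff_const.sub hsq).continuous
  have hadd : Continuous fun A : HS K Kᗮ => 1 + adjointSq A := (contDiff_const.add hsq).continuous
  exact (Units.isOpen (R := H →L[ℂ] H)).preimage hskew |>.inter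
    (((Units.isOpen (R := K →L[ℂ] K)).preimage hsub).inter
      ((Units.isOpen (R := K →L[ℂ] K)).preimage hadd))

theorem hasFDerivAt_doubleAngle_zero :
    HasFDerivAt doubleAngle ((2 : ℝ) • ContinuousLinearMap.id ℝ (HS K Kᗮ)) 0 := by
  have hsq : ContDiff ℝ 1 (adjointSq (K := K)) := contDiff_adjointSq
  have hsub : ContDiff ℝ 1 fun A : HS K Kᗮ => 1 - adjointSq A := contDiff_const.sub hsq
  have hunit : IsUnit (1 - adjointSq (0 : HS K Kᗮ)) := zero_mem_rotationDomain.2.1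
  have hinv : ContDiffAt ℝ 1 (fun A : HS K Kᗮ => Ring.inverse (1 - adjointSq A)) 0 :=
    contDiffAt_ringInverse_comp (R := K →L[ℂ] K) hsub.contDiffAt hunit
  refine ((hasFDerivAt_bilinear (HS.compRight K K Kᗮ)
    (hasFDerivAt_id (0 : HS K Kᗮ))
    (hinv.differentiableAt one_ne_zero).hasFDerivAt).const_smul (2 : ℝ)).congr_fderiv ?_
  ext1 A
  have hone : Ring.inverse (1 - adjointSq (0 : HS K Kᗮ)) = 1 := by
    rw [adjointSq_zero, sub_zero, Ring.inverse_one]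
  have hcomp : HS.compRight K K Kᗮ A 1 = A := HS.toCLM_injective rfl
  simp [hone, hcomp]

theorem exists_contDiffAt_rightInverse {𝕜 X Y : Type*} [RCLike 𝕜] [NormedAddCommGroup X]
    [NormedSpace 𝕜 X] [CompleteSpace X] [NormedAddCommGroup Y] [NormedSpace 𝕜 Y] {f : X → Y}
    {f' : X ≃L[𝕜] Y} {a : X} {n : WithTop ℕ∞} (hn : n ≠ 0) (hn_top : n ≠ (∞ : WithTop ℕ∞))
    (hf : ContDiffAt 𝕜 n f a) (hf' : HasFDerivAt f (f' : X →L[𝕜] Y) a) {U : Set X}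
    (hU : U ∈ 𝓝 a) :
    ∃ (T : Set Y) (h : Y → X), IsOpen T ∧ f a ∈ T ∧
      ∀ y ∈ T, ContDiffAt 𝕜 n h y ∧ f (h y) = y ∧ h y ∈ U := by
  let h : Y → X := hf.localInverse hf' hn
  have hstrict : HasStrictFDerivAt f (f' : X →L[𝕜] Y) a := hf.hasStrictFDerivAt' hf' hn
  have h_apply : h (f a) = a := hstrict.localInverse_apply_image
  have h_smooth : ContDiffAt 𝕜 n h (f a) := hf.to_localInverse hf' hn
  have h_mem : ∀ᶠ y in 𝓝 (f a), h y ∈ U :=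
    h_smooth.continuousAt.eventually_mem (h_apply.symm ▸ hU)
  obtain ⟨T, hT, hTo, haT⟩ := mem_nhds_iff.1
    ((h_smooth.eventually hn_top).and (hstrict.eventually_right_inverse.and h_mem))
  exact ⟨T, h, hTo, haT, hT⟩

variable (K) in
theorem exists_halfAngle : ∃ (T : Set (HS K Kᗮ)) (h : HS K Kᗮ → HS K Kᗮ), IsOpen T ∧ 0 ∈ T ∧
    ∀ B ∈ T, ContDiffAt ℝ ω h B ∧ doubleAngle (h B) = B ∧ h B ∈ rotationDomain K := by
  let f' : HS K Kᗮ ≃L[ℝ] HS K Kᗮ := ContinuousLinearEquiv.smulLeft (Units.mk0 (2 : ℝ) two_ne_zero)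
  have hf' : HasFDerivAt doubleAngle (f' : HS K Kᗮ →L[ℝ] HS K Kᗮ) 0 := hasFDerivAt_doubleAngle_zero
  simpa only [doubleAngle_zero] using exists_contDiffAt_rightInverse (by simp) (by simp)
    (contDiffAt_doubleAngle (n := ω) zero_mem_rotationDomain) hf'
    (isOpen_rotationDomain.mem_nhds zero_mem_rotationDomain)

end Rotation

section LocalSections

theorem IsSmoothAtlas.contDiffOn_pull_comp {M : Type u} [Nonempty M] {𝒜 : Set (BanachChart M)}
    (h : IsSmoothAtlas 𝒜) {c d : BanachChart M} (hc : c ∈ 𝒜) (hd : d ∈ 𝒜) {F : Type*}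
    [NormedAddCommGroup F] [NormedSpace ℝ F] {φ : d.E → F} {T : Set d.E}
    (hφ : ContDiffOn ℝ ∞ φ T) :
    ContDiffOn ℝ ∞ (c.pull fun x => φ (d.toFun x))
      (c.toFun '' (c.source ∩ (d.source ∩ d.toFun ⁻¹' T))) := by
  rw [BanachChart.image_inter (h.injOn c hc)]
  exact (hφ.comp ((h.smoothInto_inv c hc d hd).2.mono fun y hy => ⟨hy.1, hy.2.1⟩)
    fun y hy => hy.2.2).congr fun y hy => BanachChart.pull_eq (h.injOn c hc) _ hy.1

variable {H : Type u} [NormedAddCommGroup H] [InnerProductSpace ℂ H] [CompleteSpace H]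
  (Hp : Submodule ℂ H) [CompleteSpace Hp]

/-- The commutator `[(1 + R) g, P₊]` as a Hilbert–Schmidt operator depending smoothly on `R`, for a
fixed `g` with `[g, P₊]` Hilbert–Schmidt. -/
def commPlusHS (g : H →L[ℂ] H) (R : HS H H) : HS H H :=
  HS.compRight _ _ _ R (g * Hp.starProjection) -
    HS.compLeft _ _ _ Hp.starProjection (HS.compRight _ _ _ R g) + HS.ofCLM (commPlus Hp g)

theorem contDiff_commPlusHS {n : WithTop ℕ∞} (g : H →L[ℂ] H) : ContDiff ℝ n (commPlusHS Hp g) :=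
  contDiff_iff_contDiffAt.2 fun _ =>
    ((HS.contDiffAt_compRight contDiffAt_id contDiffAt_const).sub
      (HS.contDiffAt_compLeft contDiffAt_const
        (HS.contDiffAt_compRight contDiffAt_id contDiffAt_const))).add contDiffAt_const

variable {Hp}

theorem toCLM_commPlusHS {g : H →L[ℂ] H} (hg : IsHilbertSchmidt (commPlus Hp g)) (R : HS H H) :
    HS.toCLM (commPlusHS Hp g R) = commPlus Hp ((1 + HS.toCLM R) * g) := by
  calc HS.toCLM (commPlusHS Hp g R)
      = HS.toCLM R * (g * Hp.starProjection) - Hp.starProjection * (HS.toCLM R * g) +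
        commPlus Hp g := by
        rw [commPlusHS, map_add, map_sub, HS.toCLM_ofCLM hg]
        rfl
    _ = commPlus Hp ((1 + HS.toCLM R) * g) := by
        rw [commPlus, commPlus]
        noncomm_ring

theorem exists_localSection [TopologicalSpace.SeparableSpace H]
    (hplus : ¬ FiniteDimensional ℂ Hp) (hminus : ¬ FiniteDimensional ℂ Hpᗮ) (W : GrRes Hp) :
    ∃ b : LocalSection Hp, b.base = W := by
  obtain ⟨g, ⟨hgu, hgHS⟩, hgW⟩ := W.exists_mem_unitaryRes hplus hminus
  obtain ⟨T, h, hTo, hT0, hT⟩ := exists_halfAngle W.space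
  have hρ : ContDiffOn ℝ ∞ (fun B => rotationHS (h B)) T := fun B hB =>
    ((contDiffAt_rotationHS (hT B hB).2.2).comp B ((hT B hB).1.of_le le_top)).contDiffWithinAt
  have hcomm : ∀ V, commPlus Hp (rotation (h (W.coord V)) * g) =
      HS.toCLM (commPlusHS Hp g (rotationHS (h (W.coord V)))) := fun V =>
    (toCLM_commPlusHS hgHS _).symm
  exact ⟨{
    base := W
    domain := W.chart.source ∩ W.chart.toFun ⁻¹' T
    base_mem := ⟨W.self_mem_source, show W.coord W ∈ T from W.coord_self.symm ▸ hT0⟩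
    isOpen_domain := TopologicalSpace.isOpen_generateFrom_of_mem ⟨W.chart, ⟨W, rfl⟩, T, hTo, rfl⟩
    domain_subset := Set.inter_subset_left
    toFun := fun V => rotation (h (W.coord V)) * g
    mem_unitaryRes := fun V hV => by
      refine ⟨mul_mem (rotation_mem_unitary (hT _ hV.2).2.2) hgu, ?_⟩
      rw [hcomm]
      exact HS.isHilbertSchmidt _
    map_eq := fun V hV => by
      obtain ⟨-, hdouble, hmem⟩ := hT (W.coord V) hV.2
      change Hp.map ((rotation (h (W.coord V))).toLinearMap ∘ₗ g.toLinearMap) = V.space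
      rw [Submodule.map_comp, hgW, map_rotation hmem, hdouble, GrRes.space_eq_of_mem_source hV.1]
    contDiffOn := fun c hc => isSmoothAtlas_grAtlas.contDiffOn_pull_comp hc ⟨W, rfl⟩
      (φ := fun B => (1 + HS.toCLM (rotationHS (h B))) * g)
      ((contDiffOn_const.add (HS.contDiff_toCLM.comp_contDiffOn hρ)).mul contDiffOn_const)
    contDiffOn_comm := fun c hc => by
      simp only [hcomm, HS.ofCLM_toCLM]
      exact isSmoothAtlas_grAtlas.contDiffOn_pull_comp hc ⟨W, rfl⟩
        (φ := fun B => commPlusHS Hp g (rotationHS (h B)))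
        ((contDiff_commPlusHS Hp g).comp_contDiffOn hρ) }, rfl⟩

end LocalSections

/-! ### Partial isometries in terms of local cross sections -/

section Compression

variable {𝕜 H : Type*} [RCLike 𝕜] [NormedAddCommGroup H] [InnerProductSpace 𝕜 H]
  {K : Submodule 𝕜 H} [K.HasOrthogonalProjection]

/-- The extension of an operator on a subspace `K` by zero on `Kᗮ`. -/
def extend (k : K →L[𝕜] K) : H →L[𝕜] H := K.subtypeL ∘L k ∘L K.orthogonalProjectionOnto

variable (K) in
/-- The compression of an operator to a subspace. -/
def compress (T : H →L[𝕜] H) : K →L[𝕜] K := K.orthogonalProjectionOnto ∘L T ∘L K.subtypeL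

theorem compress_extend (k : K →L[𝕜] K) : compress K (extend k) = k := by
  ext x
  simp [compress, extend]

theorem extend_compress (T : H →L[𝕜] H) :
    extend (compress K T) = K.starProjection * T * K.starProjection := rfl

theorem extend_mul (k l : K →L[𝕜] K) : extend (k * l) = extend k * extend l := by
  ext x
  simp [extend]

theorem extend_one : extend (1 : K →L[𝕜] K) = K.starProjection := rfl

theorem extend_injective : Function.Injective (extend (K := K)) :=
  Function.LeftInverse.injective compress_extend

variable [CompleteSpace H] [CompleteSpace K]

theorem star_extend (k : K →L[𝕜] K) : star (extend k) = extend (star k) := by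
  simp only [extend, ContinuousLinearMap.star_eq_adjoint, ContinuousLinearMap.adjoint_comp,
    Submodule.adjoint_subtypeL, Submodule.adjoint_orthogonalProjectionOnto,
    ContinuousLinearMap.comp_assoc]

theorem star_compress (T : H →L[𝕜] H) : star (compress K T) = compress K (star T) := by
  simp only [compress, ContinuousLinearMap.star_eq_adjoint, ContinuousLinearMap.adjoint_comp,
    Submodule.adjoint_subtypeL, Submodule.adjoint_orthogonalProjectionOnto,
    ContinuousLinearMap.comp_assoc]

end Compression

section PartialIsometries

variable {H : Type u} [NormedAddCommGroup H] [InnerProductSpace ℂ H] [CompleteSpace H]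
  {Hp : Submodule ℂ H} [CompleteSpace Hp]

namespace LocalSection

variable {b g : LocalSection Hp} {p q : GrRes Hp} {k : Hp →L[ℂ] Hp}

theorem star_mul_self (hp : p ∈ b.domain) : star (b.toFun p) * b.toFun p = 1 :=
  (b.mem_unitaryRes p hp).1.1

theorem mul_star_self (hp : p ∈ b.domain) : b.toFun p * star (b.toFun p) = 1 :=
  (b.mem_unitaryRes p hp).1.2

theorem proj_mul (hp : p ∈ b.domain) : p.proj * b.toFun p = b.toFun p * Hp.starProjection := by
  rw [p.proj_eq]
  exact starProjection_mul_of_map_eq (b.mem_unitaryRes p hp).1 (b.map_eq p hp)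

theorem proj_eq (hp : p ∈ b.domain) :
    b.toFun p * Hp.starProjection * star (b.toFun p) = p.proj := by
  rw [← proj_mul hp, mul_assoc, mul_star_self hp, mul_one]

theorem star_mul_proj (hp : p ∈ b.domain) :
    star (b.toFun p) * p.proj = Hp.starProjection * star (b.toFun p) := by
  rw [← proj_eq hp, ← mul_assoc, ← mul_assoc, star_mul_self hp, one_mul]

/-- The operator from the range of `q` to the range of `p` which corresponds to the operator `k` on
`H₊` under the identifications of these ranges with `H₊` given by two local cross sections. -/
def transport (g b : LocalSection Hp) (p q : GrRes Hp) (k : Hp →L[ℂ] Hp) : H →L[ℂ] H :=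
  g.toFun p * extend k * star (b.toFun q)

theorem star_transport : star (transport g b p q k) = transport b g q p (star k) := by
  simp only [transport, star_mul, star_star, star_extend, mul_assoc]

theorem star_transport_mul_transport (hp : p ∈ g.domain) (hq : q ∈ b.domain) (hk : star k * k = 1) :
    star (transport g b p q k) * transport g b p q k = q.proj := by
  rw [star_transport]
  calc b.toFun q * extend (star k) * star (g.toFun p) * (g.toFun p * extend k * star (b.toFun q))
      = b.toFun q * extend (star k) * (star (g.toFun p) * g.toFun p) * extend k *
        star (b.toFun q) := by noncomm_ring
    _ = b.toFun q * extend (star k * k) * star (b.toFun q) := by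
        rw [star_mul_self hp, mul_one, extend_mul, mul_assoc (b.toFun q)]
    _ = q.proj := by rw [hk, extend_one, proj_eq hq]

theorem transport_mul_star_transport (hp : p ∈ g.domain) (hq : q ∈ b.domain) (hk : k * star k = 1) :
    transport g b p q k * star (transport g b p q k) = p.proj := by
  have h := star_transport_mul_transport hq hp (k := star k)
    ((congrArg (· * star k) (star_star k)).trans hk)
  rwa [← star_transport, star_star] at h

end LocalSection

namespace URes

instance : Nonempty (URes Hp) := ⟨unit (Classical.arbitrary _)⟩

theorem src_inv (u : URes Hp) : u.inv.src = u.tgt := GrRes.ext (by simp [src, tgt, inv])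

theorem tgt_inv (u : URes Hp) : u.inv.tgt = u.src := GrRes.ext (by simp [src, tgt, inv])

theorem inv_inv (u : URes Hp) : u.inv.inv = u := URes.ext (star_star _)

theorem src_mul (z : {z : URes Hp × URes Hp // src z.1 = tgt z.2}) : (mul z).src = z.1.2.src :=
  GrRes.ext (star_mul_mul z)

theorem tgt_mul (z : {z : URes Hp × URes Hp // src z.1 = tgt z.2}) : (mul z).tgt = z.1.1.tgt :=
  GrRes.ext (mul_mul_star z)

theorem src_unit (p : GrRes Hp) : (unit p).src = p := by
  refine GrRes.ext ?_
  change star p.proj * p.proj = p.proj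
  rw [p.isStarProjection.isSelfAdjoint.star_eq, p.isStarProjection.isIdempotentElem]

theorem tgt_unit (p : GrRes Hp) : (unit p).tgt = p := by
  refine GrRes.ext ?_
  change p.proj * star p.proj = p.proj
  rw [p.isStarProjection.isSelfAdjoint.star_eq, p.isStarProjection.isIdempotentElem]

theorem op_mul_src (u : URes Hp) : u.op * u.src.proj = u.op := by
  change u.op * (star u.op * u.op) = u.op
  have hidem : star u.op * u.op * (star u.op * u.op) = star u.op * u.op :=
    u.isStarProjection_source.isIdempotentElem
  rw [← sub_eq_zero, ← CStarRing.star_mul_self_eq_zero_iff, star_sub, star_mul, star_mul, star_star]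
  calc (star u.op * u.op * star u.op - star u.op) * (u.op * (star u.op * u.op) - u.op)
      = star u.op * u.op * (star u.op * u.op) * (star u.op * u.op) -
        star u.op * u.op * (star u.op * u.op) - star u.op * u.op * (star u.op * u.op) +
        star u.op * u.op := by noncomm_ring
    _ = 0 := by rw [hidem, hidem]; noncomm_ring

theorem tgt_mul_op (u : URes Hp) : u.tgt.proj * u.op = u.op :=
  (mul_assoc _ _ _).trans u.op_mul_src

section Reduced

variable {b b' g : LocalSection Hp} {u v : URes Hp}

theorem reduced_eq (b g : LocalSection Hp) (u : URes Hp) :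
    reduced b g u = compress Hp (star (g.toFun u.tgt) * u.op * b.toFun u.src) := rfl

theorem extend_reduced (hb : u.src ∈ b.domain) (hg : u.tgt ∈ g.domain) :
    extend (reduced b g u) = star (g.toFun u.tgt) * u.op * b.toFun u.src := by
  rw [reduced_eq, extend_compress]
  calc Hp.starProjection * (star (g.toFun u.tgt) * u.op * b.toFun u.src) * Hp.starProjection
      = Hp.starProjection * star (g.toFun u.tgt) * u.op *
        (b.toFun u.src * Hp.starProjection) := by noncomm_ring
    _ = star (g.toFun u.tgt) * (u.tgt.proj * u.op * u.src.proj) * b.toFun u.src := by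
        rw [← LocalSection.proj_mul hb, ← LocalSection.star_mul_proj hg]; noncomm_ring
    _ = star (g.toFun u.tgt) * u.op * b.toFun u.src := by rw [tgt_mul_op, op_mul_src]

theorem op_eq_transport (hb : u.src ∈ b.domain) (hg : u.tgt ∈ g.domain) :
    u.op = g.transport b u.tgt u.src (reduced b g u) := by
  rw [LocalSection.transport, extend_reduced hb hg]
  calc u.op = (g.toFun u.tgt * star (g.toFun u.tgt)) * u.op *
        (b.toFun u.src * star (b.toFun u.src)) := by
        rw [LocalSection.mul_star_self hg, LocalSection.mul_star_self hb, one_mul, mul_one]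
    _ = g.toFun u.tgt * (star (g.toFun u.tgt) * u.op * b.toFun u.src) * star (b.toFun u.src) := by
        noncomm_ring

theorem ext_reduced (hb : u.src ∈ b.domain) (hg : u.tgt ∈ g.domain) (hsrc : u.src = v.src)
    (htgt : u.tgt = v.tgt) (hreduced : reduced b g u = reduced b g v) : u = v := by
  apply URes.ext
  rw [op_eq_transport hb hg, op_eq_transport (u := v) (hsrc ▸ hb) (htgt ▸ hg), hsrc, htgt, hreduced]

theorem reduced_inv (b g : LocalSection Hp) (u : URes Hp) :
    reduced g b u.inv = star (reduced b g u) := by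
  rw [reduced_eq, reduced_eq, star_compress, src_inv, tgt_inv, star_mul, star_mul, star_star,
    mul_assoc]
  rfl

theorem reduced_mul (z : {z : URes Hp × URes Hp // src z.1 = tgt z.2})
    (hg : z.1.1.tgt ∈ g.domain) (hb : z.1.1.src ∈ b.domain) (hb' : z.1.2.src ∈ b'.domain) :
    reduced b' g (mul z) = reduced b g z.1.1 * reduced b' b z.1.2 := by
  apply extend_injective
  rw [extend_mul, extend_reduced hb hg, extend_reduced hb' (z.2 ▸ hb),
    extend_reduced (by rwa [src_mul]) (by rwa [tgt_mul]), src_mul, tgt_mul, ← z.2]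
  calc star (g.toFun z.1.1.tgt) * (z.1.1.op * z.1.2.op) * b'.toFun z.1.2.src
      = star (g.toFun z.1.1.tgt) * z.1.1.op * (b.toFun z.1.1.src * star (b.toFun z.1.1.src)) *
        z.1.2.op * b'.toFun z.1.2.src := by
        rw [LocalSection.mul_star_self hb, mul_one]; noncomm_ring
    _ = star (g.toFun z.1.1.tgt) * z.1.1.op * b.toFun z.1.1.src *
        (star (b.toFun z.1.1.src) * z.1.2.op * b'.toFun z.1.2.src) := by noncomm_ring

theorem star_reduced_mul_reduced (hb : u.src ∈ b.domain) (hg : u.tgt ∈ g.domain) :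
    star (reduced b g u) * reduced b g u = 1 := by
  apply extend_injective
  rw [extend_mul, ← star_extend, extend_reduced hb hg, extend_one, star_mul, star_mul, star_star]
  calc star (b.toFun u.src) * (star u.op * g.toFun u.tgt) *
        (star (g.toFun u.tgt) * u.op * b.toFun u.src)
      = star (b.toFun u.src) * star u.op * (g.toFun u.tgt * star (g.toFun u.tgt)) * u.op *
        b.toFun u.src := by noncomm_ring
    _ = star (b.toFun u.src) * (star u.op * u.op) * b.toFun u.src := by
        rw [LocalSection.mul_star_self hg]; noncomm_ring
    _ = Hp.starProjection * star (b.toFun u.src) * b.toFun u.src :=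
        congrArg (· * b.toFun u.src) (LocalSection.star_mul_proj hb)
    _ = Hp.starProjection := by rw [mul_assoc, LocalSection.star_mul_self hb, mul_one]

theorem reduced_mem_unitary (hb : u.src ∈ b.domain) (hg : u.tgt ∈ g.domain) :
    reduced b g u ∈ unitary (Hp →L[ℂ] Hp) := by
  refine ⟨star_reduced_mul_reduced hb hg, ?_⟩
  have h := star_reduced_mul_reduced (u := u.inv) (b := g) (g := b) (by rwa [src_inv])
    (by rwa [tgt_inv])
  have hstar : star (star (reduced b g u)) = reduced b g u :=
    star_star (reduced b g u)
  rwa [reduced_inv, hstar] at h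

theorem exists_reduced_eq {p q : GrRes Hp} (hp : p ∈ g.domain) (hq : q ∈ b.domain)
    {k : Hp →L[ℂ] Hp} (hk : k ∈ unitary (Hp →L[ℂ] Hp)) :
    ∃ u : URes Hp, u.tgt = p ∧ u.src = q ∧ reduced b g u = k := by
  have hsource := LocalSection.star_transport_mul_transport hp hq hk.1
  have htarget := LocalSection.transport_mul_star_transport hp hq hk.2
  let u : URes Hp := ⟨g.transport b p q k, hsource ▸ q.isStarProjection,
    htarget ▸ p.isStarProjection, hsource ▸ q.range_mem, htarget ▸ p.range_mem⟩
  have htgt : u.tgt = p := GrRes.ext htarget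
  have hsrc : u.src = q := GrRes.ext hsource
  refine ⟨u, htgt, hsrc, extend_injective ?_⟩
  rw [extend_reduced (by rwa [hsrc]) (by rwa [htgt]), htgt, hsrc]
  calc star (g.toFun p) * (g.toFun p * extend k * star (b.toFun q)) * b.toFun q
      = (star (g.toFun p) * g.toFun p) * extend k * (star (b.toFun q) * b.toFun q) := by
        noncomm_ring
    _ = extend k := by
        rw [LocalSection.star_mul_self hp, LocalSection.star_mul_self hq, one_mul, mul_one]

end Reduced

section Coord

variable {a : UnitaryChart Hp} {b g : LocalSection Hp} {u : URes Hp}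
  {x : HS g.base.space g.base.spaceᗮ} {y : HS b.base.space b.base.spaceᗮ} {z : SkewOp Hp}

variable (a b g) in
theorem image_coord : coord a b g '' chartSource a b g =
    (g.base.coord '' g.domain) ×ˢ (b.base.coord '' b.domain) ×ˢ (a.toFun '' a.source) := by
  ext ⟨x, y, z⟩
  constructor
  · rintro ⟨u, ⟨hb, hg, ha⟩, hu⟩
    obtain ⟨rfl, rfl, rfl⟩ : g.base.coord u.tgt = x ∧ b.base.coord u.src = y ∧
        a.toFun (reduced b g u) = z := by simpa [coord] using hu
    exact ⟨⟨_, hg, rfl⟩, ⟨_, hb, rfl⟩, ⟨_, ha, rfl⟩⟩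
  · rintro ⟨⟨p, hp, rfl⟩, ⟨q, hq, rfl⟩, ⟨k, hk, rfl⟩⟩
    obtain ⟨u, rfl, rfl, rfl⟩ := exists_reduced_eq hp hq (a.source_subset hk)
    exact ⟨u, ⟨hq, hp, hk⟩, rfl⟩

variable (a b g) in
theorem injOn_coord : Set.InjOn (coord a b g) (chartSource a b g) := by
  rintro u ⟨hub, hug, hua⟩ v ⟨hvb, hvg, hva⟩ huv
  obtain ⟨htgt, hsrc, hreduced⟩ : g.base.coord u.tgt = g.base.coord v.tgt ∧
      b.base.coord u.src = b.base.coord v.src ∧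
      a.toFun (reduced b g u) = a.toFun (reduced b g v) := by simpa [coord] using huv
  exact ext_reduced hub hug
    (b.base.injOn_coord (b.domain_subset hub) (b.domain_subset hvb) hsrc)
    (g.base.injOn_coord (g.domain_subset hug) (g.domain_subset hvg) htgt) (a.injOn hua hva hreduced)

theorem coord_tgt_src (hu : coord a b g u = (x, y, z)) :
    g.base.coord u.tgt = x ∧ b.base.coord u.src = y :=
  ⟨congrArg Prod.fst hu, congrArg (fun w => w.2.1) hu⟩

theorem symm_coord (hu : u ∈ chartSource a b g) (hcoord : coord a b g u = (x, y, z)) :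
    a.symm z = reduced b g u :=
  (congrArg (fun w => a.symm w.2.2) hcoord).symm.trans (a.symm_toFun hu.2.2)

theorem inv_coord {c : UnitaryChart Hp} (hu : u ∈ chartSource a b g)
    (hcoord : coord a b g u = (x, y, z)) (hz : star (a.symm z) ∈ c.source) :
    u.inv ∈ chartSource c g b ∧ coord c g b u.inv = (y, x, c.toFun (star (a.symm z))) := by
  have hreduced : star (a.symm z) = reduced g b u.inv := by
    rw [reduced_inv, symm_coord hu hcoord]
  obtain ⟨rfl, rfl⟩ := coord_tgt_src hcoord
  obtain ⟨hb, hg, -⟩ := hu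
  rw [hreduced] at hz ⊢
  refine ⟨⟨?_, ?_, hz⟩, ?_⟩
  · rwa [src_inv]
  · rwa [tgt_inv]
  · rw [coord, src_inv, tgt_inv]

theorem mul_coord {a' a'' : UnitaryChart Hp} {b' : LocalSection Hp} {v : URes Hp}
    {w : HS b'.base.space b'.base.spaceᗮ} {z' : SkewOp Hp}
    (hu : u ∈ chartSource a b g) (hv : v ∈ chartSource a' b' b)
    (hcoord_u : coord a b g u = (x, y, z)) (hcoord_v : coord a' b' b v = (y, w, z'))
    (hz : a.symm z * a'.symm z' ∈ a''.source) :
    ∃ h : u.src = v.tgt, mul ⟨(u, v), h⟩ ∈ chartSource a'' b' g ∧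
      coord a'' b' g (mul ⟨(u, v), h⟩) = (x, w, a''.toFun (a.symm z * a'.symm z')) := by
  have hsymm_u := symm_coord hu hcoord_u
  have hsymm_v := symm_coord hv hcoord_v
  obtain ⟨rfl, rfl⟩ := coord_tgt_src hcoord_u
  obtain ⟨hvu, rfl⟩ := coord_tgt_src hcoord_v
  obtain ⟨hub, hug, -⟩ := hu
  obtain ⟨hvb, hvg, -⟩ := hv
  have hst : u.src = v.tgt :=
    b.base.injOn_coord (b.domain_subset hub) (b.domain_subset hvg) hvu.symm
  have hreduced : a.symm z * a'.symm z' = reduced b' g (mul ⟨(u, v), hst⟩) := by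
    rw [hsymm_u, hsymm_v, reduced_mul ⟨(u, v), hst⟩ hug hub hvb]
  rw [hreduced] at hz ⊢
  refine ⟨hst, ⟨?_, ?_, hz⟩, ?_⟩
  · rwa [src_mul]
  · rwa [tgt_mul]
  · rw [coord, src_mul, tgt_mul]

end Coord

end URes

end PartialIsometries

/-! ### The Banach Lie groupoid of partial isometries -/

section Groupoid

variable {H : Type u} [NormedAddCommGroup H] [InnerProductSpace ℂ H] [CompleteSpace H]
  {Hp : Submodule ℂ H} [CompleteSpace Hp]
  {Y : Type*} [NormedAddCommGroup Y] [NormedSpace ℝ Y]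

theorem GrRes.contDiffAt_coord {W : GrRes Hp} {D : Set Y} {v : Y → GrRes Hp} {y : Y}
    (hv : SmoothInto (grAtlas Hp) D v) (hy : y ∈ D) (hW : v y ∈ W.chart.source) :
    ContDiffAt ℝ ∞ (fun y => W.coord (v y)) y :=
  (hv W.chart ⟨W, rfl⟩).2.contDiffAt ((hv W.chart ⟨W, rfl⟩).1.mem_nhds ⟨hy, hW⟩)

namespace LocalSection

variable {D : Set Y} {v : Y → GrRes Hp} {b : LocalSection Hp} {y : Y}

variable (b) in
theorem isOpen_image : IsOpen (b.base.coord '' b.domain) := by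
  have h := isSmoothAtlas_grAtlas.isOpen_iff.1 b.isOpen_domain b.base.chart ⟨b.base, rfl⟩
  rwa [Set.inter_eq_right.2 b.domain_subset] at h

theorem isOpen_preimage (hv : SmoothInto (grAtlas Hp) D v) : IsOpen (D ∩ v ⁻¹' b.domain) :=
  hv.isOpen_preimage isSmoothAtlas_grAtlas b.isOpen_domain

theorem contDiffAt_comp (hv : SmoothInto (grAtlas Hp) D v) (hy : y ∈ D) (hb : v y ∈ b.domain) :
    ContDiffAt ℝ ∞ (fun y => b.toFun (v y)) y :=
  (hv.contDiffOn_comp isSmoothAtlas_grAtlas b.isOpen_domain b.contDiffOn).contDiffAt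
    ((isOpen_preimage hv).mem_nhds ⟨hy, hb⟩)

theorem contDiffAt_proj (hv : SmoothInto (grAtlas Hp) D v) (hy : y ∈ D) (hb : v y ∈ b.domain) :
    ContDiffAt ℝ ∞ (fun y => (v y).proj) y := by
  have hsection := contDiffAt_comp hv hy hb
  refine ((hsection.mul (contDiffAt_const (c := Hp.starProjection))).mul
    (contDiffAt_star hsection)).congr_of_eventuallyEq ?_
  filter_upwards [(isOpen_preimage hv).mem_nhds ⟨hy, hb⟩] with z hz
  exact (proj_eq hz.2).symm

end LocalSection

namespace URes

/-- A smooth family of partial isometries: both the operators and their initial and final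
projectors depend smoothly on the parameter. Smoothness of the operators alone is smoothness in
the operator norm, which does not control the Hilbert–Schmidt coordinates of the projectors. -/
structure SmoothFamily (D : Set Y) (v : Y → URes Hp) : Prop where
  src : SmoothInto (grAtlas Hp) D fun y => (v y).src
  tgt : SmoothInto (grAtlas Hp) D fun y => (v y).tgt
  op : ∀ y ∈ D, ContDiffAt ℝ ∞ (fun y => (v y).op) y

open Classical in
/-- The product of two partial isometries, with the arbitrary value `u` when `u` and `v` are not
composable. -/
def mulTotal (u v : URes Hp) : URes Hp := if h : u.src = v.tgt then mul ⟨(u, v), h⟩ else u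

theorem mulTotal_eq {u v : URes Hp} (h : u.src = v.tgt) : mulTotal u v = mul ⟨(u, v), h⟩ :=
  dif_pos h

namespace SmoothFamily

variable {D : Set Y} {v w : Y → URes Hp} {y : Y}

theorem comp {Z : Type*} [NormedAddCommGroup Z] [NormedSpace ℝ Z] (hv : SmoothFamily D v)
    {D' : Set Z} (hD' : IsOpen D') {f : Z → Y} (hf : ContDiffOn ℝ ∞ f D')
    (hfD : Set.MapsTo f D' D) : SmoothFamily D' (v ∘ f) where
  src := hv.src.comp hD' hf hfD
  tgt := hv.tgt.comp hD' hf hfD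
  op z hz := (hv.op (f z) (hfD hz)).comp z (hf.contDiffAt (hD'.mem_nhds hz))

theorem inv (hv : SmoothFamily D v) : SmoothFamily D fun y => (v y).inv where
  src := hv.tgt.congr fun _ _ => src_inv _
  tgt := hv.src.congr fun _ _ => tgt_inv _
  op y hy := contDiffAt_star (hv.op y hy)

theorem mulTotal (hv : SmoothFamily D v) (hw : SmoothFamily D w)
    (hvw : ∀ y ∈ D, (v y).src = (w y).tgt) :
    SmoothFamily D fun y => (v y).mulTotal (w y) where
  src := hw.src.congr fun y hy => by rw [mulTotal_eq (hvw y hy), src_mul]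
  tgt := hv.tgt.congr fun y hy => by rw [mulTotal_eq (hvw y hy), tgt_mul]
  op y hy := by
    refine ((hv.op y hy).mul (hw.op y hy)).congr_of_eventuallyEq ?_
    filter_upwards [(hv.src.isOpen isSmoothAtlas_grAtlas).mem_nhds hy] with z hz
    exact congrArg URes.op (mulTotal_eq (hvw z hz))

variable {a : UnitaryChart Hp} {b g : LocalSection Hp}

theorem contDiffAt_reduced (hv : SmoothFamily D v) (hy : y ∈ D) (hb : (v y).src ∈ b.domain)
    (hg : (v y).tgt ∈ g.domain) : ContDiffAt ℝ ∞ (fun y => reduced b g (v y)) y :=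
  contDiffAt_comp contDiffAt_const (contDiffAt_comp
    (((contDiffAt_star (LocalSection.contDiffAt_comp hv.tgt hy hg)).mul (hv.op y hy)).mul
      (LocalSection.contDiffAt_comp hv.src hy hb)) contDiffAt_const)

theorem isOpen_preimage_chartSource (hv : SmoothFamily D v) :
    IsOpen (D ∩ v ⁻¹' chartSource a b g) := by
  obtain ⟨O, hO, hOa⟩ := a.isOpen_source
  let D' := (D ∩ (fun y => (v y).src) ⁻¹' b.domain) ∩ (D ∩ (fun y => (v y).tgt) ⁻¹' g.domain)
  have hD' : IsOpen D' :=
    (LocalSection.isOpen_preimage hv.src).inter (LocalSection.isOpen_preimage hv.tgt)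
  have hcont : ContinuousOn (fun y => reduced b g (v y)) D' := fun y hy =>
    (hv.contDiffAt_reduced hy.1.1 hy.1.2 hy.2.2).continuousAt.continuousWithinAt
  convert hcont.isOpen_inter_preimage hD' hO using 1
  ext y
  constructor
  · rintro ⟨hy, hb, hg, ha⟩
    rw [hOa] at ha
    exact ⟨⟨⟨hy, hb⟩, hy, hg⟩, ha.1⟩
  · rintro ⟨⟨⟨hy, hb⟩, -, hg⟩, ha⟩
    refine ⟨hy, hb, hg, ?_⟩
    rw [hOa]
    exact ⟨ha, reduced_mem_unitary hb hg⟩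

theorem smoothInto (hv : SmoothFamily D v) (A : Set (UnitaryChart Hp))
    (S : Set (LocalSection Hp)) : SmoothInto (atlas A S) D v := by
  rintro _ ⟨a, -, b, -, g, -, rfl⟩
  have hopen : IsOpen (D ∩ v ⁻¹' chartSource a b g) := hv.isOpen_preimage_chartSource
  refine ⟨hopen, fun y hy => ContDiffAt.contDiffWithinAt ?_⟩
  obtain ⟨hyD, hb, hg, -⟩ := id hy
  refine (GrRes.contDiffAt_coord hv.tgt hyD (g.domain_subset hg)).prodMk
    ((GrRes.contDiffAt_coord hv.src hyD (b.domain_subset hb)).prodMk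
      (a.contDiffAt_comp (hv.contDiffAt_reduced hyD hb hg) ?_))
  filter_upwards [hopen.mem_nhds hy] with z hz
  exact hz.2.2.2

end SmoothFamily

section ChartInverse

variable (a : UnitaryChart Hp) (b g : LocalSection Hp)

theorem isOpen_image_coord : IsOpen (coord a b g '' chartSource a b g) := by
  rw [image_coord]
  exact g.isOpen_image.prod (b.isOpen_image.prod a.isOpen_image)

variable {a b g} {y : (chart a b g).E}

theorem tgt_chart_inv (hy : y ∈ coord a b g '' chartSource a b g) :
    ((chart a b g).inv y).tgt = g.base.chart.inv y.1 := by
  obtain ⟨u, hu, rfl⟩ := hy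
  exact (congrArg tgt (BanachChart.inv_toFun (injOn_coord a b g) hu)).trans
    (BanachChart.inv_toFun g.base.injOn_coord (g.domain_subset hu.2.1)).symm

theorem src_chart_inv (hy : y ∈ coord a b g '' chartSource a b g) :
    ((chart a b g).inv y).src = b.base.chart.inv y.2.1 := by
  obtain ⟨u, hu, rfl⟩ := hy
  exact (congrArg src (BanachChart.inv_toFun (injOn_coord a b g) hu)).trans
    (BanachChart.inv_toFun b.base.injOn_coord (b.domain_subset hu.1)).symm

theorem reduced_chart_inv (hy : y ∈ coord a b g '' chartSource a b g) :
    reduced b g ((chart a b g).inv y) = a.symm y.2.2 := by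
  obtain ⟨u, hu, rfl⟩ := hy
  exact (congrArg (reduced b g) (BanachChart.inv_toFun (injOn_coord a b g) hu)).trans
    (a.symm_toFun hu.2.2).symm

variable (a b g)

theorem smoothInto_tgt_chart_inv : SmoothInto (grAtlas Hp) (coord a b g '' chartSource a b g)
    fun y : (chart a b g).E => ((chart a b g).inv y).tgt :=
  (g.base.smoothInto_inv.comp (isOpen_image_coord a b g) contDiff_fst.contDiffOn
    (Set.mapsTo_univ _ _)).congr fun _ hy => tgt_chart_inv hy

theorem smoothInto_src_chart_inv : SmoothInto (grAtlas Hp) (coord a b g '' chartSource a b g)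
    fun y : (chart a b g).E => ((chart a b g).inv y).src :=
  (b.base.smoothInto_inv.comp (isOpen_image_coord a b g)
    (contDiff_fst.comp contDiff_snd).contDiffOn
    (Set.mapsTo_univ _ _)).congr fun _ hy => src_chart_inv hy

theorem smoothFamily_chart_inv :
    SmoothFamily (coord a b g '' chartSource a b g) (chart a b g).inv where
  src := smoothInto_src_chart_inv a b g
  tgt := smoothInto_tgt_chart_inv a b g
  op y hy := by
    have hmem : ∀ z ∈ coord a b g '' chartSource a b g, (chart a b g).inv z ∈ chartSource a b g :=
      fun z hz => BanachChart.inv_mem (c := chart a b g) hz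
    have hyz : y.2.2 ∈ a.toFun '' a.source := ((image_coord a b g).subset hy).2.2
    have hsymm : ContDiffAt ℝ ∞ (fun y : (chart a b g).E => a.symm y.2.2) y :=
      (a.smooth_symm.contDiffAt (a.isOpen_image.mem_nhds hyz)).comp y
        (contDiff_snd.comp contDiff_snd).contDiffAt
    have hextend : ContDiffAt ℝ ∞ (fun y : (chart a b g).E => extend (a.symm y.2.2)) y :=
      contDiffAt_comp contDiffAt_const (contDiffAt_comp hsymm contDiffAt_const)
    have htgt := LocalSection.contDiffAt_comp (smoothInto_tgt_chart_inv a b g) hy (hmem y hy).2.1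
    have hsrc := LocalSection.contDiffAt_comp (smoothInto_src_chart_inv a b g) hy (hmem y hy).1
    refine ((htgt.mul hextend).mul (contDiffAt_star hsrc)).congr_of_eventuallyEq ?_
    filter_upwards [(isOpen_image_coord a b g).mem_nhds hy] with z hz
    rw [op_eq_transport (hmem z hz).1 (hmem z hz).2.1, reduced_chart_inv hz]
    rfl

end ChartInverse

section WithTgt

variable (a : UnitaryChart Hp) (b g : LocalSection Hp)

/-- The partial isometry with target `p` whose other two coordinates are those of `e`. This moves
the target of a partial isometry inside a chart, which yields smooth sections of the target map
and makes pairs of partial isometries composable. -/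
def withTgt (p : GrRes Hp) (e : (chart a b g).E) : URes Hp :=
  (chart a b g).inv (g.base.coord p, e.2)

variable {a b g} {u : URes Hp}

theorem withTgt_coord (hu : u ∈ chartSource a b g) : withTgt a b g u.tgt (coord a b g u) = u :=
  BanachChart.inv_toFun (injOn_coord a b g) hu

theorem tgt_withTgt {p : GrRes Hp} {e : (chart a b g).E} (hp : p ∈ g.domain)
    (he : e.2 ∈ (b.base.coord '' b.domain) ×ˢ (a.toFun '' a.source)) :
    (withTgt a b g p e).tgt = p :=
  (tgt_chart_inv (y := (g.base.coord p, e.2))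
      ((image_coord a b g).superset ⟨⟨p, hp, rfl⟩, he⟩)).trans
    (BanachChart.inv_toFun g.base.injOn_coord (g.domain_subset hp))

theorem smoothFamily_withTgt {D : Set Y} {p : Y → GrRes Hp} (hp : SmoothInto (grAtlas Hp) D p) :
    SmoothFamily ((D ∩ p ⁻¹' g.domain) ×ˢ
        (Prod.snd ⁻¹' ((b.base.coord '' b.domain) ×ˢ (a.toFun '' a.source))))
      (fun z : Y × (chart a b g).E => withTgt a b g (p z.1) z.2) := by
  refine (smoothFamily_chart_inv a b g).comp
    (f := fun z : Y × (chart a b g).E => (g.base.coord (p z.1), z.2.2)) ?_ ?_ ?_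
  · exact (LocalSection.isOpen_preimage hp).prod
      ((b.isOpen_image.prod a.isOpen_image).preimage continuous_snd)
  · intro z hz
    have hcoord : ContDiffAt ℝ ∞ (fun z : Y × (chart a b g).E => g.base.coord (p z.1)) z :=
      (GrRes.contDiffAt_coord hp hz.1.1 (g.domain_subset hz.1.2)).comp z
        (contDiff_fst (F := (chart a b g).E)).contDiffAt
    have hsnd : ContDiffAt ℝ ∞ (fun z : Y × (chart a b g).E => z.2.2) z :=
      (contDiff_snd.comp contDiff_snd).contDiffAt
    exact (hcoord.prodMk hsnd).contDiffWithinAt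
  · exact fun z hz => (image_coord a b g).superset ⟨⟨_, hz.1.2, rfl⟩, hz.2⟩

theorem exists_section_tgt (hu : u ∈ chartSource a b g) :
    ∃ (U : Set (GrRes Hp)) (τ : GrRes Hp → URes Hp), u.tgt ∈ U ∧ τ u.tgt = u ∧
      (∀ p ∈ U, (τ p).tgt = p) ∧
      ∀ d ∈ grAtlas Hp, SmoothFamily (d.toFun '' d.source ∩ d.inv ⁻¹' U) (τ ∘ d.inv) := by
  have hcoord : (coord a b g u).2 ∈ (b.base.coord '' b.domain) ×ˢ (a.toFun '' a.source) :=
    ⟨⟨_, hu.1, rfl⟩, ⟨_, hu.2.2, rfl⟩⟩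
  refine ⟨g.domain, fun p => withTgt a b g p (coord a b g u), hu.2.1, withTgt_coord hu,
    fun p hp => tgt_withTgt hp hcoord, fun d hd => ?_⟩
  have hinv := isSmoothAtlas_grAtlas.smoothInto_inv d hd
  exact (smoothFamily_withTgt hinv).comp (LocalSection.isOpen_preimage hinv)
    (f := fun z => (z, coord a b g u)) (contDiff_id.prodMk contDiff_const).contDiffOn
    fun z hz => ⟨hz, hcoord⟩

theorem exists_smoothFamily_mul (a a' : UnitaryChart Hp) (b b' g g' : LocalSection Hp) :
    ∃ (D : Set ((chart a b g).E × (chart a' b' g').E))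
      (v : (chart a b g).E × (chart a' b' g').E → URes Hp), SmoothFamily D v ∧
      ∀ w : {z : URes Hp × URes Hp // src z.1 = tgt z.2},
        w.1.1 ∈ chartSource a b g → w.1.2 ∈ chartSource a' b' g' →
        (coord a b g w.1.1, coord a' b' g' w.1.2) ∈ D ∧
          v (coord a b g w.1.1, coord a' b' g' w.1.2) = mul w := by
  have hfst := smoothFamily_chart_inv a b g
  have hsnd := smoothFamily_withTgt (a := a') (b := b') (g := g') hfst.src
  refine ⟨_, fun z => ((chart a b g).inv z.1).mulTotal
      (withTgt a' b' g' ((chart a b g).inv z.1).src z.2),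
    (hfst.comp (hsnd.src.isOpen isSmoothAtlas_grAtlas) contDiff_fst.contDiffOn
      fun z hz => hz.1.1).mulTotal hsnd fun z hz => (tgt_withTgt hz.1.2 hz.2).symm, ?_⟩
  rintro ⟨⟨u, v⟩, huv⟩ hu hv
  have hu_inv : (chart a b g).inv (coord a b g u) = u :=
    BanachChart.inv_toFun (injOn_coord a b g) hu
  have hu_src : ((chart a b g).inv (coord a b g u)).src = v.tgt := (congrArg src hu_inv).trans huv
  have hv_withTgt : withTgt a' b' g' ((chart a b g).inv (coord a b g u)).src (coord a' b' g' v) =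
      v := by
    rw [hu_src, withTgt_coord hv]
  refine ⟨⟨⟨⟨u, hu, rfl⟩, ?_⟩, ⟨_, hv.1, rfl⟩, ⟨_, hv.2.2, rfl⟩⟩, ?_⟩
  · rw [Set.mem_preimage, hu_src]
    exact hv.2.1
  · exact (congrArg₂ URes.mulTotal hu_inv hv_withTgt).trans (mulTotal_eq huv)

end WithTgt

section StructureMaps

variable {A : Set (UnitaryChart Hp)} {S : Set (LocalSection Hp)}

theorem isSmoothAtlas_atlas (hA : ∀ k ∈ unitary (Hp →L[ℂ] Hp), ∃ a ∈ A, k ∈ a.source)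
    (hS : ∀ p : GrRes Hp, ∃ b ∈ S, p ∈ b.domain) : IsSmoothAtlas (atlas A S) where
  injOn := by
    rintro _ ⟨a, -, b, -, g, -, rfl⟩
    exact injOn_coord a b g
  cover u := by
    obtain ⟨b, hb, hub⟩ := hS u.src
    obtain ⟨g, hg, hug⟩ := hS u.tgt
    obtain ⟨a, ha, hua⟩ := hA _ (reduced_mem_unitary hub hug)
    exact ⟨_, ⟨a, ha, b, hb, g, hg, rfl⟩, hub, hug, hua⟩
  smoothInto_inv := by
    rintro _ ⟨a, -, b, -, g, -, rfl⟩
    exact (smoothFamily_chart_inv a b g).smoothInto A S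

theorem isSmoothMap_src (h : IsSmoothAtlas (atlas A S)) :
    IsSmoothMap (atlas A S) (grAtlas Hp) src := by
  refine h.isSmoothMap ?_
  rintro _ ⟨a, -, b, -, g, -, rfl⟩
  exact (smoothFamily_chart_inv a b g).src

theorem isSmoothMap_tgt (h : IsSmoothAtlas (atlas A S)) :
    IsSmoothMap (atlas A S) (grAtlas Hp) tgt := by
  refine h.isSmoothMap ?_
  rintro _ ⟨a, -, b, -, g, -, rfl⟩
  exact (smoothFamily_chart_inv a b g).tgt

theorem isSmoothMap_inv (h : IsSmoothAtlas (atlas A S)) :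
    IsSmoothMap (atlas A S) (atlas A S) (inv (Hp := Hp)) := by
  refine h.isSmoothMap ?_
  rintro _ ⟨a, -, b, -, g, -, rfl⟩
  exact (smoothFamily_chart_inv a b g).inv.smoothInto A S

theorem isSmoothMap_unit (hS : ∀ p : GrRes Hp, ∃ b ∈ S, p ∈ b.domain) :
    IsSmoothMap (grAtlas Hp) (atlas A S) (unit (Hp := Hp)) := by
  refine isSmoothAtlas_grAtlas.isSmoothMap fun c hc => ?_
  have hinv := isSmoothAtlas_grAtlas.smoothInto_inv c hc
  refine SmoothFamily.smoothInto ⟨?_, ?_, fun y hy => ?_⟩ A S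
  · exact hinv.congr fun y _ => src_unit _
  · exact hinv.congr fun y _ => tgt_unit _
  · obtain ⟨b, -, hb⟩ := hS (c.inv y)
    exact LocalSection.contDiffAt_proj hinv hy hb

theorem isSubmersionMap_tgt (h : IsSmoothAtlas (atlas A S)) :
    IsSubmersionMap (atlas A S) (grAtlas Hp) tgt := by
  refine h.isSubmersionMap isSmoothAtlas_grAtlas (isSmoothMap_tgt h) fun u => ?_
  obtain ⟨_, ⟨a, -, b, -, g, -, rfl⟩, hu⟩ := h.cover u
  obtain ⟨U, τ, huU, hτu, hτ, hsmooth⟩ := exists_section_tgt hu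
  exact ⟨U, τ, huU, hτu, hτ, fun d hd => (hsmooth d hd).smoothInto A S⟩

theorem isSubmersionMap_src (h : IsSmoothAtlas (atlas A S)) :
    IsSubmersionMap (atlas A S) (grAtlas Hp) src := by
  refine h.isSubmersionMap isSmoothAtlas_grAtlas (isSmoothMap_src h) fun u => ?_
  obtain ⟨_, ⟨a, -, b, -, g, -, rfl⟩, hu⟩ := h.cover u.inv
  obtain ⟨U, τ, huU, hτu, hτ, hsmooth⟩ := exists_section_tgt hu
  rw [tgt_inv] at huU hτu
  refine ⟨U, fun p => (τ p).inv, huU, ?_, fun p hp => ?_, fun d hd =>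
    (hsmooth d hd).inv.smoothInto A S⟩
  · exact (congrArg inv hτu).trans (inv_inv u)
  · exact (src_inv _).trans (hτ p hp)

theorem isSmoothOnSubset_mul :
    IsSmoothOnSubset (atlas A S) (atlas A S) (atlas A S) (mul (Hp := Hp)) := by
  refine isSmoothOnSubset_of_smoothInto ?_
  rintro _ ⟨a, -, b, -, g, -, rfl⟩ _ ⟨a', -, b', -, g', -, rfl⟩
  obtain ⟨D, v, hv, hvmul⟩ := exists_smoothFamily_mul a a' b b' g g'
  exact ⟨D, v, hv.smoothInto A S, hvmul⟩

theorem isBanachManifold_atlas (h : IsSmoothAtlas (atlas A S)) : IsBanachManifold (atlas A S) := by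
  refine h.isBanachManifold (f := URes.op) (fun u v huv => URes.ext huv) ?_
  rintro _ ⟨a, -, b, -, g, -, rfl⟩ y hy
  exact ((smoothFamily_chart_inv a b g).op y hy).continuousAt.continuousWithinAt

theorem isBanachManifold_grAtlas (hS : ∀ p : GrRes Hp, ∃ b ∈ S, p ∈ b.domain) :
    IsBanachManifold (grAtlas Hp) := by
  refine isSmoothAtlas_grAtlas.isBanachManifold (f := GrRes.proj)
    (fun p q hpq => GrRes.ext hpq) fun c hc y hy => ?_
  obtain ⟨b, -, hb⟩ := hS (c.inv y)
  exact (LocalSection.contDiffAt_proj (isSmoothAtlas_grAtlas.smoothInto_inv c hc)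
    hy hb).continuousAt.continuousWithinAt

theorem isEmbedding_unit (h : IsSmoothAtlas (atlas A S))
    (hS : ∀ p : GrRes Hp, ∃ b ∈ S, p ∈ b.domain) :
    @Topology.IsEmbedding _ _ (atlasTopology (grAtlas Hp)) (atlasTopology (atlas A S))
      (unit (Hp := Hp)) := by
  let _ : TopologicalSpace (GrRes Hp) := atlasTopology (grAtlas Hp)
  let _ : TopologicalSpace (URes Hp) := atlasTopology (atlas A S)
  exact Topology.IsEmbedding.of_leftInverse src_unit (h.continuous (isSmoothMap_src h))
    (isSmoothAtlas_grAtlas.continuous (isSmoothMap_unit hS))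

theorem isBanachLieGroupoid (hA : ∀ k ∈ unitary (Hp →L[ℂ] Hp), ∃ a ∈ A, k ∈ a.source)
    (hS : ∀ p : GrRes Hp, ∃ b ∈ S, p ∈ b.domain) :
    IsBanachLieGroupoid (atlas A S) (grAtlas Hp) src tgt mul unit inv where
  manifold_total := isBanachManifold_atlas (isSmoothAtlas_atlas hA hS)
  manifold_base := isBanachManifold_grAtlas hS
  source_surjective p := ⟨unit p, src_unit p⟩
  source_submersion := isSubmersionMap_src (isSmoothAtlas_atlas hA hS)
  target_surjective p := ⟨unit p, tgt_unit p⟩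
  target_submersion := isSubmersionMap_tgt (isSmoothAtlas_atlas hA hS)
  mul_smooth := isSmoothOnSubset_mul
  mul_defined_iff u v w := by simp only [src_mul, tgt_mul, exists_prop, and_comm]
  mul_assoc u v w _ _ _ _ := URes.ext (mul_assoc u.op v.op w.op)
  unit_embedding := isEmbedding_unit (isSmoothAtlas_atlas hA hS) hS
  mul_unit := by
    rintro u _ rfl
    exact ⟨(tgt_unit _).symm, URes.ext u.op_mul_src⟩
  unit_mul := by
    rintro u _ rfl
    exact ⟨src_unit _, URes.ext u.tgt_mul_op⟩
  inv_diffeo := ⟨isSmoothMap_inv (isSmoothAtlas_atlas hA hS), inv,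
    isSmoothMap_inv (isSmoothAtlas_atlas hA hS), inv_inv, inv_inv⟩
  mul_inv u := ⟨(tgt_inv u).symm, URes.ext rfl⟩
  inv_mul u := ⟨src_inv u, URes.ext rfl⟩

end StructureMaps

end URes

end Groupoid

end

end RestrictedGroupoid

theorem theorem5p4 {H : Type u} [NormedAddCommGroup H] [InnerProductSpace ℂ H] [CompleteSpace H]
    [TopologicalSpace.SeparableSpace H] (Hp : Submodule ℂ H) [CompleteSpace Hp]
    (hplus : ¬ FiniteDimensional ℂ Hp) (hminus : ¬ FiniteDimensional ℂ Hpᗮ) :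
    -- local cross sections and charts of `U₊` exist around every point
    (∀ p : GrRes Hp, ∃ b : LocalSection Hp, b.base = p) ∧
    (∀ k ∈ unitary (Hp →L[ℂ] Hp), ∃ a : UnitaryChart Hp, k ∈ a.source) ∧
    ∀ (A : Set (UnitaryChart Hp)) (S : Set (LocalSection Hp)),
      (∀ k ∈ unitary (Hp →L[ℂ] Hp), ∃ a ∈ A, k ∈ a.source) →
      (∀ p : GrRes Hp, ∃ b ∈ S, p ∈ b.domain) →
      IsBanachLieGroupoid (URes.atlas A S) (grAtlas Hp)
        URes.src URes.tgt URes.mul URes.unit URes.inv ∧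
      -- the image of a chart is a product, on which target and source are projections
      (∀ a ∈ A, ∀ b ∈ S, ∀ g ∈ S,
        URes.coord a b g '' URes.chartSource a b g =
          (g.base.coord '' g.domain) ×ˢ (b.base.coord '' b.domain) ×ˢ (a.toFun '' a.source) ∧
        ∀ u ∈ URes.chartSource a b g, ∀ x y z, URes.coord a b g u = (x, y, z) →
          g.base.coord u.tgt = x ∧ b.base.coord u.src = y) ∧
      -- inversion in charts
      (∀ a ∈ A, ∀ a' ∈ A, ∀ b ∈ S, ∀ g ∈ S, ∀ u ∈ URes.chartSource a b g,
        ∀ x y z, URes.coord a b g u = (x, y, z) → star (a.symm z) ∈ a'.source →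
          u.inv ∈ URes.chartSource a' g b ∧
          URes.coord a' g b u.inv = (y, x, a'.toFun (star (a.symm z)))) ∧
      -- multiplication in charts
      (∀ a ∈ A, ∀ a' ∈ A, ∀ a'' ∈ A, ∀ b ∈ S, ∀ g ∈ S, ∀ b' ∈ S,
        ∀ u ∈ URes.chartSource a b g, ∀ v ∈ URes.chartSource a' b' b,
        ∀ x y w z z', URes.coord a b g u = (x, y, z) →
          URes.coord a' b' b v = (y, w, z') →
          a.symm z * a'.symm z' ∈ a''.source →
          ∃ h : u.src = v.tgt, URes.mul ⟨(u, v), h⟩ ∈ URes.chartSource a'' b' g ∧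
            URes.coord a'' b' g (URes.mul ⟨(u, v), h⟩) =
              (x, w, a''.toFun (a.symm z * a'.symm z'))) :=
  ⟨exists_localSection hplus hminus, fun _ hk => UnitaryChart.exists_mem_source hk,
    fun _ _ hA hS => ⟨URes.isBanachLieGroupoid hA hS,
      fun a _ b _ g _ =>
        ⟨URes.image_coord a b g, fun _ _ _ _ _ hcoord => URes.coord_tgt_src hcoord⟩,
      fun _ _ _ _ _ _ _ _ _ hu _ _ _ hcoord hstar => URes.inv_coord hu hcoord hstar,
      fun _ _ _ _ _ _ _ _ _ _ _ _ _ hu _ hv _ _ _ _ _ hcoord hcoord' hmul =>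
        URes.mul_coord hu hv hcoord hcoord' hmul⟩⟩
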